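/- Let $M$ be a Riemann surface and $y:M\to\mathbb S^4$ a smooth conformal immersion. Let $\langle\cdot,\cdot\rangle$ be the Lorentz form $-X_0Y_0+\sum_{i=1}^{5}X_iY_i$ on $\mathbb R^{5,1}$, extended complex bilinearly, and identify $x\in\mathbb S^4$ with the null line $[1,x]$. In a local holomorphic coordinate $z$ let $Y$ be the canonical lift of $y$, i.e. the positive multiple of $(1,y)$ with $\langle Y_z,Y_{\bar z}\rangle=\tfrac12$; let $V=\mathrm{span}\{Y,\mathrm{Re}\,Y_z,\mathrm{Im}\,Y_z,Y_{z\bar z}\}$ and let $D$ be the normal connection on $V^\perp$ (the derivative followed by orthogonal projection to $V^\perp$, extended complex linearly). The Hopfian $\kappa$ is the $V^\perp\otimes\mathbb C$-component of $Y_{zz}$; its zeros are the umbilic points of $y$, and $y$ is called isotropic if $\langle\kappa,\kappa\rangle\equiv0$. The Möbius metric is $e^{2\omega}|dz|^2=4\langle\kappa,\bar\kappa\rangle|dz|^2$ and its Gaussian curvature, the Möbius curvature, is $\mathcal K=-4e^{-2\omega}\omega_{z\bar z}$. If $y$ is isotropic without umbilic points, then $D_{\bar z}\kappa$ is a multiple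 of $\kappa$; define $\mu$ by $D_{\bar z}\kappa+\tfrac{\bar\mu}{2}\kappa=0$ and put $\rho=\bar\mu_z-2\langle\kappa,\bar\kappa\rangle$ and $\mathcal P=\rho/\langle\kappa,\bar\kappa\rangle$. **Theorem.** Let $y:M\to\mathbb S^4$ be an isotropic conformal immersion without umbilic points. Then the following three conditions are equivalent: 1. $\mathcal P\equiv0$ on $M$ (in every local holomorphic coordinate); 2. $\mathcal K\equiv2$ on $M$ (in every local holomorphic coordinate); 3. $y$ is locally Möbius equivalent to a complex curve in $\mathbb C^2\cong\mathbb R^4$ for a suitable orthogonal complex structure on $\mathbb R^4$; that is, every point of $M$ has an open neighbourhood $U$ for which there are an orthogonal complex structure $J$ on $\mathbb R^4$, a holomorphic immersion $h:U\to(\mathbb R^4,J)$ and a Möbius transformation $\Phi$ of $\mathbb S^4$ such that $\Phi\circ y=\sigma^{-1}\circ h$ on $U$, where $\sigma^{-1}:\mathbb R^4\to\mathbb S^4$ is inverse stereographic projection. -/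

import Mathlib

open scoped Manifold ContDiff ComplexConjugate

noncomputable section

namespace MoebiusSurface

/-- The unit sphere `S^n` in `ℝ^(n+1)`. -/
abbrev Sph (n : ℕ) : Type := Metric.sphere (0 : EuclideanSpace ℝ (Fin (n + 1))) 1

/-! ### Minkowski space and the light cone model of `S^n` -/

/-- The Minkowski form `-X₀Y₀ + ∑ XᵢYᵢ` on `R^(m+1)`. For `R = ℝ` this is the form of `ℝ^{m,1}`,
for `R = ℂ` its complex bilinear extension. -/
def mink {R : Type*} [CommRing R] {m : ℕ} (X Y : Fin (m + 1) → R) : R :=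
  -(X 0 * Y 0) + ∑ i : Fin m, X i.succ * Y i.succ

/-- Entrywise complex conjugation on complexified Minkowski space. -/
def vconj {m : ℕ} (X : Fin m → ℂ) : Fin m → ℂ := fun i => conj (X i)

/-- The light-like vector `(1, x)` representing the point `x`. -/
def nullLift {m : ℕ} (x : EuclideanSpace ℝ (Fin m)) : Fin (m + 1) → ℝ :=
  Fin.cons 1 (fun i => x i)

/-- Möbius transformations of `S^n`: the projective actions of linear isometries of
`ℝ^{n+1,1}` on the projectivised light cone. -/
def IsMoebius {n : ℕ} (Φ : Sph n → Sph n) : Prop :=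
  ∃ A : (Fin (n + 2) → ℝ) →ₗ[ℝ] (Fin (n + 2) → ℝ),
    (∀ X Y, mink (A X) (A Y) = mink X Y) ∧
    ∀ x : Sph n, ∃ c : ℝ, c ≠ 0 ∧ A (nullLift x.1) = c • nullLift (Φ x).1

/-- The point `((‖x‖² - 1)/(‖x‖² + 1), 2x/(‖x‖² + 1))` of `ℝ × ℝ^n`. -/
def invStereoVec {n : ℕ} (x : EuclideanSpace ℝ (Fin n)) : EuclideanSpace ℝ (Fin (n + 1)) :=
  WithLp.toLp 2 (Fin.cons ((‖x‖ ^ 2 - 1) / (‖x‖ ^ 2 + 1)) fun i => 2 * x i / (‖x‖ ^ 2 + 1))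

theorem invStereoVec_mem {n : ℕ} (x : EuclideanSpace ℝ (Fin n)) :
    invStereoVec x ∈ Metric.sphere (0 : EuclideanSpace ℝ (Fin (n + 1))) 1 := by
  have hpos : ‖x‖ ^ 2 + 1 ≠ 0 := by positivity
  have hx : ∑ i : Fin n, x i ^ 2 = ‖x‖ ^ 2 := (EuclideanSpace.real_norm_sq_eq x).symm
  have h : ‖invStereoVec x‖ ^ 2 = 1 := by
    rw [EuclideanSpace.real_norm_sq_eq, Fin.sum_univ_succ]
    simp only [invStereoVec, Fin.cons_zero, Fin.cons_succ, div_pow, mul_pow]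
    rw [← Finset.sum_div, ← Finset.mul_sum, hx]
    field_simp
    ring
  rw [mem_sphere_zero_iff_norm]
  nlinarith [norm_nonneg (invStereoVec x)]

/-- Inverse stereographic projection `ℝ^n → S^n` (from the pole `(1, 0, …, 0)`). -/
def invStereo {n : ℕ} (x : EuclideanSpace ℝ (Fin n)) : Sph n := ⟨invStereoVec x, invStereoVec_mem x⟩

/-! ### Invariants of a surface in a local complex coordinate

`f : ℂ → ℝ^(n+1)` is a surface in `S^n` written in a coordinate `z`; all functions are only
meant on the open set of `ℂ` on which the coordinate lives. -/

section Wirtinger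

variable {W : Type*} [NormedAddCommGroup W] [NormedSpace ℂ W]

/-- `∂F/∂z = (F_x - i F_y)/2`. -/
def dz (F : ℂ → W) (z : ℂ) : W :=
  (1 / 2 : ℂ) • (fderiv ℝ F z 1 - Complex.I • fderiv ℝ F z Complex.I)

/-- `∂F/∂z̄ = (F_x + i F_y)/2`. -/
def dzbar (F : ℂ → W) (z : ℂ) : W :=
  (1 / 2 : ℂ) • (fderiv ℝ F z 1 + Complex.I • fderiv ℝ F z Complex.I)

end Wirtinger

section Coordinate

variable {n : ℕ} (f : ℂ → EuclideanSpace ℝ (Fin (n + 1)))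

/-- The lift `(1, f)`, as a map into complexified Minkowski space. -/
def lift (z : ℂ) : Fin (n + 2) → ℂ := fun i => (nullLift (f z) i : ℂ)

/-- The canonical lift `Y`: the positive multiple of `(1, f)` with `|dY|² = |dz|²`, that is
`⟨Y_z, Y_z̄⟩ = 1/2`. -/
def Y (z : ℂ) : Fin (n + 2) → ℂ :=
  (((Real.sqrt (2 * (mink (dz (lift f) z) (dzbar (lift f) z)).re))⁻¹ : ℝ) : ℂ) • lift f z

/-- The section `N` of the mean curvature sphere bundle `V = span {Y, Y_z, Y_z̄, Y_zz̄}` with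
`⟨N, N⟩ = 0`, `⟨N, Y⟩ = -1`, `⟨N, Y_z⟩ = 0`. -/
def N (z : ℂ) : Fin (n + 2) → ℂ :=
  (2 : ℂ) • dzbar (dz (Y f)) z +
    (2 * mink (dzbar (dz (Y f)) z) (dzbar (dz (Y f)) z)) • Y f z

/-- Orthogonal projection onto the (complexified) normal bundle `V^⊥`. In the frame
`Y, Y_z, Y_z̄, N` of `V` the only nonzero products are `⟨Y, N⟩ = -1`, `⟨Y_z, Y_z̄⟩ = 1/2`. -/
def nproj (z : ℂ) (X : Fin (n + 2) → ℂ) : Fin (n + 2) → ℂ :=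
  X + mink X (N f z) • Y f z + mink X (Y f z) • N f z
    - (2 * mink X (dzbar (Y f) z)) • dz (Y f) z
    - (2 * mink X (dz (Y f) z)) • dzbar (Y f) z

/-- The Hopfian `κ`: the normal part of `Y_zz`, so that `Y_zz + (s/2) Y = κ`. -/
def kappa (z : ℂ) : Fin (n + 2) → ℂ := nproj f z (dz (dz (Y f)) z)

/-- `⟨κ, κ̄⟩`. -/
def kappaSq (z : ℂ) : ℂ := mink (kappa f z) (vconj (kappa f z))

/-- `D_z̄ κ`, with `D` the normal connection. -/
def DzbarKappa (z : ℂ) : Fin (n + 2) → ℂ := nproj f z (dzbar (kappa f) z)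

/-- The function `μ` with `D_z̄ κ + (μ̄/2) κ = 0`, for surfaces on which `D_z̄ κ` is a multiple
of `κ ≠ 0`; see `mu_eq`. -/
def mu (z : ℂ) : ℂ := conj (-2 * mink (DzbarKappa f z) (vconj (kappa f z)) / kappaSq f z)

/-- `mu` is the only solution of its defining equation. -/
theorem mu_eq {z m : ℂ} (h0 : kappaSq f z ≠ 0)
    (hm : DzbarKappa f z + (conj m / 2) • kappa f z = 0) : m = mu f z := by
  have h1 : DzbarKappa f z = (-(conj m / 2)) • kappa f z := by
    rw [neg_smul]; exact eq_neg_of_add_eq_zero_left hm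
  have h2 : mink (DzbarKappa f z) (vconj (kappa f z)) = -(conj m / 2) * kappaSq f z := by
    rw [h1]
    simp only [mink, kappaSq, Pi.smul_apply, smul_eq_mul, mul_add, Finset.mul_sum]
    congr 1
    · ring
    · exact Finset.sum_congr rfl fun i _ => by ring
  rw [mu, h2]
  have h3 : -2 * (-(conj m / 2) * kappaSq f z) / kappaSq f z = conj m := by field_simp
  rw [h3, Complex.conj_conj]

/-- `ρ = μ̄_z - 2 ⟨κ, κ̄⟩`. -/
def rho (z : ℂ) : ℂ := dz (fun w => conj (mu f w)) z - 2 * kappaSq f z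

/-- The invariant `𝒫 = ρ / ⟨κ, κ̄⟩`. -/
def invP (z : ℂ) : ℂ := rho f z / kappaSq f z

/-- `ω`, where the Möbius metric is `e^{2ω} |dz|² = 4 ⟨κ, κ̄⟩ |dz|²`. -/
def omega (z : ℂ) : ℝ := Real.log (4 * (kappaSq f z).re) / 2

/-- The Möbius curvature `𝒦 = -4 e^{-2ω} ω_{z z̄}`, the Gaussian curvature of the Möbius metric. -/
def curvK (z : ℂ) : ℝ :=
  -4 * Real.exp (-2 * omega f z) * (dzbar (dz fun w => (omega f w : ℂ)) z).re

end Coordinate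

/-! ### Surfaces on a Riemann surface -/

section Surface

variable {M : Type*} [TopologicalSpace M] [ChartedSpace ℂ M]

/-- The local complex coordinates of the Riemann surface `M`. -/
def Coords (M : Type*) [TopologicalSpace M] [ChartedSpace ℂ M] :
    Set (OpenPartialHomeomorph M ℂ) :=
  IsManifold.maximalAtlas 𝓘(ℂ) ω M

/-- `y` in the local coordinate `e`, as a map into `ℝ^(n+1)`. -/
def inCoord {n : ℕ} (y : M → Sph n) (e : OpenPartialHomeomorph M ℂ) (z : ℂ) :
    EuclideanSpace ℝ (Fin (n + 1)) :=
  (y (e.symm z)).1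

/-- `y` is a smooth conformal immersion: in each coordinate `z = x + iy`, the partial derivatives
in the two coordinate directions are nonzero, orthogonal and of equal length. -/
structure IsConformalImmersion {n : ℕ} (y : M → Sph n) : Prop where
  smooth : ∀ e ∈ Coords M, ContDiffOn ℝ ∞ (inCoord y e) e.target
  immersion : ∀ e ∈ Coords M, ∀ z ∈ e.target, fderiv ℝ (inCoord y e) z 1 ≠ 0
  norm_eq : ∀ e ∈ Coords M, ∀ z ∈ e.target,
    ‖fderiv ℝ (inCoord y e) z Complex.I‖ = ‖fderiv ℝ (inCoord y e) z 1‖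
  orthogonal : ∀ e ∈ Coords M, ∀ z ∈ e.target,
    inner ℝ (fderiv ℝ (inCoord y e) z 1) (fderiv ℝ (inCoord y e) z Complex.I) = 0

/-- `⟨κ, κ⟩ = 0` everywhere. -/
def IsIsotropic {n : ℕ} (y : M → Sph n) : Prop :=
  ∀ e ∈ Coords M, ∀ z ∈ e.target, mink (kappa (inCoord y e) z) (kappa (inCoord y e) z) = 0

/-- `κ` vanishes nowhere; its zeros are the umbilic points. -/
def WithoutUmbilics {n : ℕ} (y : M → Sph n) : Prop :=
  ∀ e ∈ Coords M, ∀ z ∈ e.target, kappa (inCoord y e) z ≠ 0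

/-- An orthogonal complex structure on `ℝ^m`. -/
def IsOrthogonalComplexStructure {m : ℕ}
    (J : EuclideanSpace ℝ (Fin m) →ₗ[ℝ] EuclideanSpace ℝ (Fin m)) : Prop :=
  (∀ v, J (J v) = -v) ∧ ∀ v w, inner ℝ (J v) (J w) = (inner ℝ v w : ℝ)

/-- On the open set `U`, the map `h` is a complex curve in `(ℝ^m, J)`: a smooth immersion which is
holomorphic, i.e. `h_y = J h_x` in each local coordinate `x + iy`. -/
structure IsComplexCurveOn {m : ℕ}
    (J : EuclideanSpace ℝ (Fin m) →ₗ[ℝ] EuclideanSpace ℝ (Fin m))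
    (h : M → EuclideanSpace ℝ (Fin m)) (U : Set M) : Prop where
  smooth : ∀ e ∈ Coords M, ContDiffOn ℝ ∞ (h ∘ e.symm) (e.target ∩ e.symm ⁻¹' U)
  immersion : ∀ e ∈ Coords M, ∀ z ∈ e.target ∩ e.symm ⁻¹' U, fderiv ℝ (h ∘ e.symm) z 1 ≠ 0
  holomorphic : ∀ e ∈ Coords M, ∀ z ∈ e.target ∩ e.symm ⁻¹' U,
    fderiv ℝ (h ∘ e.symm) z Complex.I = J (fderiv ℝ (h ∘ e.symm) z 1)

/-- Near each point, `y : M → S^n` is Möbius equivalent to a complex curve in `ℝ^n` with a suitable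
orthogonal complex structure, `ℝ^n` being placed in `S^n` by inverse stereographic projection. -/
def LocallyMoebiusComplexCurve {n : ℕ} (y : M → Sph n) : Prop :=
  ∀ p : M, ∃ U : Set M, IsOpen U ∧ p ∈ U ∧
    ∃ J : EuclideanSpace ℝ (Fin n) →ₗ[ℝ] EuclideanSpace ℝ (Fin n),
      IsOrthogonalComplexStructure J ∧
      ∃ h : M → EuclideanSpace ℝ (Fin n), IsComplexCurveOn J h U ∧
      ∃ Φ : Sph n → Sph n, IsMoebius Φ ∧ ∀ q ∈ U, Φ (y q) = invStereo (h q)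

end Surface

end MoebiusSurface

end

noncomputable section

namespace MoebiusSurface

/-! ### Algebra of the Minkowski form -/

section MinkAlgebra

variable {R : Type*} [CommRing R] {m : ℕ}

/-! Write k = ⟨κ, κ̄⟩. Over `S^4` the normal bundle has rank two, so for an isotropic surface
without umbilic points Y, Y_z, Y_z̄, N, κ, κ̄ is a moving frame, and its derivatives are expressed
through k, μ and the Schwarzian s (`IsoOn.dz_kappa`, `IsoOn.dzbar_kappa`). The integrability
conditions are (log k)_{zz̄} = -2k - Re μ_z̄ (Ricci), s = μ_z - μ²/2 (Codazzi) and s_z̄ = 2k_z - 2μk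
(Gauss).

The Ricci equation gives 𝒦 = 2 + Re 𝒫 / 2 (`IsoOn.curvK_eq`), so 𝒫 = 0 implies 𝒦 = 2. Conversely,
Codazzi and Gauss together give Q_z = Q (μ - (log k)_z) for Q = conj 𝒫. If Q is purely imaginary,
conjugation yields the analogous formula for Q_z̄, and equality of the mixed derivatives forces kQ²
= 0 (`IsoOn.conjP_eq_zero`).

Geometrically, 𝒫 = 0 means that locally all mean curvature spheres pass through one point off the
surface. A complex curve in ℝ⁴ is harmonic, so its mean curvature spheres contain the point at
infinity, represented by a null vector E with ⟨κ, E⟩ = 0. Differentiating this relation twice gives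
𝒫 = 0 (`IsoOn.dzbar_mu_of_null`). In the other direction, 𝒫 = 0 makes the line of an explicit null
section of V constant (`IsoOn.hasW_nullSection`); a rotation moves it to the pole of stereographic
projection. In the Euclidean space E^⊥/E the image h of the surface has h_z = p, where p and the
image q of a multiple of κ span a constant maximal isotropic subspace of ℂ⁴. This subspace is the
i-eigenspace of an orthogonal complex structure for which h is holomorphic (`complexStructure_eq`,
`IsoOn.exists_complexCurve`). -/

theorem mink_comm (X Y : Fin (m + 1) → R) : mink X Y = mink Y X := by
  simp only [mink, mul_comm]

theorem mink_add_left (X X' Y : Fin (m + 1) → R) : mink (X + X') Y = mink X Y + mink X' Y := by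
  simp only [mink, Pi.add_apply, add_mul, Finset.sum_add_distrib]; ring

theorem mink_smul_left (c : R) (X Y : Fin (m + 1) → R) : mink (c • X) Y = c * mink X Y := by
  simp only [mink, Pi.smul_apply, smul_eq_mul, mul_add, Finset.mul_sum, mul_assoc, mul_neg]

theorem mink_add_right (X Y Y' : Fin (m + 1) → R) : mink X (Y + Y') = mink X Y + mink X Y' := by
  rw [mink_comm, mink_add_left, mink_comm Y, mink_comm Y']

theorem mink_smul_right (c : R) (X Y : Fin (m + 1) → R) : mink X (c • Y) = c * mink X Y := by
  rw [mink_comm, mink_smul_left, mink_comm]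

theorem mink_neg_left (X Y : Fin (m + 1) → R) : mink (-X) Y = -mink X Y := by
  rw [← neg_one_smul R X, mink_smul_left, neg_one_mul]

theorem mink_neg_right (X Y : Fin (m + 1) → R) : mink X (-Y) = -mink X Y := by
  rw [mink_comm, mink_neg_left, mink_comm]

theorem mink_sub_left (X X' Y : Fin (m + 1) → R) : mink (X - X') Y = mink X Y - mink X' Y := by
  rw [sub_eq_add_neg, mink_add_left, mink_neg_left, ← sub_eq_add_neg]

theorem mink_sub_right (X Y Y' : Fin (m + 1) → R) : mink X (Y - Y') = mink X Y - mink X Y' := by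
  rw [sub_eq_add_neg, mink_add_right, mink_neg_right, ← sub_eq_add_neg]

theorem mink_zero_left (X : Fin (m + 1) → R) : mink 0 X = 0 := by
  simp [mink]

theorem mink_zero_right (X : Fin (m + 1) → R) : mink X 0 = 0 := by
  simp [mink]

/-- The Minkowski form as a bilinear map. -/
def minkBilin : (Fin (m + 1) → R) →ₗ[R] (Fin (m + 1) → R) →ₗ[R] R :=
  LinearMap.mk₂ R mink mink_add_left mink_smul_left mink_add_right mink_smul_right

@[simp] theorem minkBilin_apply (X Y : Fin (m + 1) → R) : minkBilin X Y = mink X Y := rfl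

end MinkAlgebra

/-! ### Complex conjugation and the Minkowski form. -/

section Conj

variable {m : ℕ}

@[simp] theorem vconj_vconj (X : Fin m → ℂ) : vconj (vconj X) = X := by
  funext i; simp [vconj]

theorem vconj_add (X X' : Fin m → ℂ) : vconj (X + X') = vconj X + vconj X' := by
  funext i; simp [vconj]

theorem vconj_sub (X X' : Fin m → ℂ) : vconj (X - X') = vconj X - vconj X' := by
  funext i; simp [vconj]

theorem vconj_smul (c : ℂ) (X : Fin m → ℂ) : vconj (c • X) = conj c • vconj X := by
  funext i; simp [vconj]

theorem mink_vconj (X X' : Fin (m + 1) → ℂ) : mink (vconj X) (vconj X') = conj (mink X X') := by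
  simp [mink, vconj, map_sum]

end Conj

/-! ### Wirtinger calculus -/

section Calculus

variable {W W₁ W₂ W₃ : Type*} [NormedAddCommGroup W] [NormedSpace ℂ W]
  [NormedAddCommGroup W₁] [NormedSpace ℂ W₁] [NormedAddCommGroup W₂] [NormedSpace ℂ W₂]
  [NormedAddCommGroup W₃] [NormedSpace ℂ W₃]

/-- `F` is smooth on `Ω`. -/
def SmoothOn (F : ℂ → W) (Ω : Set ℂ) : Prop := ContDiffOn ℝ ∞ F Ω

/-- `F` is differentiable at `z`, with Wirtinger derivatives `a` and `b`. -/
def HasW (F : ℂ → W) (a b : W) (z : ℂ) : Prop :=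
  DifferentiableAt ℝ F z ∧ dz F z = a ∧ dzbar F z = b

/-- Together with `HasW.congr` this is how identities are differentiated throughout: two
computations of the Wirtinger derivatives of functions that agree on an open set are equated. -/
theorem HasW.unique {F : ℂ → W} {a b a' b' : W} {z : ℂ} (h : HasW F a b z)
    (h' : HasW F a' b' z) : a = a' ∧ b = b' :=
  ⟨h.2.1.symm.trans h'.2.1, h.2.2.symm.trans h'.2.2⟩

theorem HasW.congr {F G : ℂ → W} {a b : W} {z : ℂ} {Ω : Set ℂ} (h : HasW F a b z)
    (hΩ : IsOpen Ω) (hz : z ∈ Ω) (hFG : ∀ w ∈ Ω, G w = F w) : HasW G a b z := by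
  have he : G =ᶠ[nhds z] F := Filter.eventually_of_mem (hΩ.mem_nhds hz) hFG
  refine ⟨h.1.congr_of_eventuallyEq he, ?_, ?_⟩
  · rw [← h.2.1]; simp only [dz, he.fderiv_eq]
  · rw [← h.2.2]; simp only [dzbar, he.fderiv_eq]

theorem hasW_const (c : W) (z : ℂ) : HasW (fun _ => c) 0 0 z := by
  refine ⟨differentiableAt_const c, ?_, ?_⟩ <;> simp [dz, dzbar]

theorem fderiv_one_eq (F : ℂ → W) (z : ℂ) : fderiv ℝ F z 1 = dz F z + dzbar F z := by
  simp only [dz, dzbar]; module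

theorem fderiv_I_eq (F : ℂ → W) (z : ℂ) :
    fderiv ℝ F z Complex.I = Complex.I • (dz F z - dzbar F z) := by
  simp only [dz, dzbar, smul_sub, smul_add, smul_smul]
  have h : Complex.I * (1 / 2 * Complex.I) = -(1 / 2) := by
    linear_combination (1 / 2 : ℂ) * Complex.I_mul_I
  rw [h]; module

theorem HasW.clm {F : ℂ → W₁} {a b : W₁} {z : ℂ} (h : HasW F a b z) (L : W₁ →L[ℂ] W₂) :
    HasW (fun w => L (F w)) (L a) (L b) z := by
  have h1 : HasFDerivAt (fun w => L (F w)) ((L.restrictScalars ℝ).comp (fderiv ℝ F z)) z :=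
    (L.restrictScalars ℝ).hasFDerivAt.comp z h.1.hasFDerivAt
  refine ⟨h1.differentiableAt, ?_, ?_⟩
  · rw [← h.2.1]; simp [dz, h1.fderiv]
  · rw [← h.2.2]; simp [dzbar, h1.fderiv]

theorem HasW.bilin {F : ℂ → W₁} {G : ℂ → W₂} {a b : W₁} {c d : W₂} {z : ℂ}
    (hF : HasW F a b z) (hG : HasW G c d z) (B : W₁ →L[ℂ] W₂ →L[ℂ] W₃) :
    HasW (fun w => B (F w) (G w)) (B a (G z) + B (F z) c) (B b (G z) + B (F z) d) z := by
  have h1 : HasFDerivAt (fun w => B (F w) (G w)) _ z :=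
    (((ContinuousLinearMap.restrictScalarsL ℂ W₂ W₃ ℝ ℝ).comp
      (B.restrictScalars ℝ))).hasFDerivAt_of_bilinear hF.1.hasFDerivAt hG.1.hasFDerivAt
  refine ⟨h1.differentiableAt, ?_, ?_⟩
  · rw [← hF.2.1, ← hG.2.1]; simp [dz, h1.fderiv]; module
  · rw [← hF.2.2, ← hG.2.2]; simp [dzbar, h1.fderiv]; module

theorem HasW.add {F G : ℂ → W} {a b c d : W} {z : ℂ}
    (hF : HasW F a b z) (hG : HasW G c d z) : HasW (fun w => F w + G w) (a + c) (b + d) z := by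
  have h1 := hF.1.hasFDerivAt.add hG.1.hasFDerivAt
  refine ⟨h1.differentiableAt, ?_, ?_⟩
  · rw [← hF.2.1, ← hG.2.1]; simp only [dz]; erw [h1.fderiv]; simp; module
  · rw [← hF.2.2, ← hG.2.2]; simp only [dzbar]; erw [h1.fderiv]; simp; module

theorem HasW.smul {F : ℂ → ℂ} {G : ℂ → W} {a b : ℂ} {c d : W} {z : ℂ}
    (hF : HasW F a b z) (hG : HasW G c d z) :
    HasW (fun w => F w • G w) (a • G z + F z • c) (b • G z + F z • d) z :=
  hF.bilin hG (ContinuousLinearMap.lsmul ℂ ℂ)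

theorem HasW.mul {F G : ℂ → ℂ} {a b c d : ℂ} {z : ℂ}
    (hF : HasW F a b z) (hG : HasW G c d z) :
    HasW (fun w => F w * G w) (a * G z + F z * c) (b * G z + F z * d) z :=
  hF.smul hG

theorem HasW.const_smul {G : ℂ → W} {c d : W} {z : ℂ} (k : ℂ) (hG : HasW G c d z) :
    HasW (fun w => k • G w) (k • c) (k • d) z := by
  simpa using (hasW_const k z).smul hG

theorem HasW.const_mul {G : ℂ → ℂ} {c d : ℂ} {z : ℂ} (k : ℂ) (hG : HasW G c d z) :
    HasW (fun w => k * G w) (k * c) (k * d) z :=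
  hG.const_smul k

theorem HasW.neg {F : ℂ → W} {a b : W} {z : ℂ} (hF : HasW F a b z) :
    HasW (fun w => -F w) (-a) (-b) z := by
  simpa using hF.const_smul (-1)

theorem HasW.sub {F G : ℂ → W} {a b c d : W} {z : ℂ}
    (hF : HasW F a b z) (hG : HasW G c d z) : HasW (fun w => F w - G w) (a - c) (b - d) z := by
  simpa only [sub_eq_add_neg] using hF.add hG.neg

theorem HasW.inv {F : ℂ → ℂ} {a b : ℂ} {z : ℂ} (hF : HasW F a b z) (h0 : F z ≠ 0) :
    HasW (fun w => (F w)⁻¹) (-a / F z ^ 2) (-b / F z ^ 2) z := by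
  have h1 : HasFDerivAt (fun w => (F w)⁻¹) _ z :=
    (((hasDerivAt_inv h0).hasFDerivAt).restrictScalars ℝ).comp z hF.1.hasFDerivAt
  refine ⟨h1.differentiableAt, ?_, ?_⟩
  · rw [← hF.2.1]; simp [dz, h1.fderiv]; field_simp; ring
  · rw [← hF.2.2]; simp [dzbar, h1.fderiv]; field_simp; ring

theorem HasW.conjugate {F : ℂ → ℂ} {a b : ℂ} {z : ℂ} (hF : HasW F a b z) :
    HasW (fun w => conj (F w)) (conj b) (conj a) z := by
  have h2 : (starRingEnd ℂ) 2 = 2 := Complex.conj_ofNat 2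
  have h1 : HasFDerivAt (fun w => (starRingEnd ℂ) (F w)) _ z :=
    (Complex.conjCLE : ℂ →L[ℝ] ℂ).hasFDerivAt.comp z hF.1.hasFDerivAt
  refine ⟨h1.differentiableAt, ?_, ?_⟩
  · rw [← hF.2.2]; simp [dz, dzbar, h1.fderiv, h2]; ring
  · rw [← hF.2.1]; simp [dz, dzbar, h1.fderiv, h2]

theorem hasW_of_pi {m : ℕ} {F : ℂ → Fin m → ℂ} {a b : Fin m → ℂ} {z : ℂ}
    (h : ∀ i, HasW (fun w => F w i) (a i) (b i) z) : HasW F a b z := by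
  have h1 : HasFDerivAt F _ z := hasFDerivAt_pi.2 fun i => (h i).1.hasFDerivAt
  refine ⟨h1.differentiableAt, ?_, ?_⟩
  · funext i; rw [← (h i).2.1]; simp [dz, h1.fderiv]
  · funext i; rw [← (h i).2.2]; simp [dzbar, h1.fderiv]

theorem HasW.apply {m : ℕ} {F : ℂ → Fin m → ℂ} {a b : Fin m → ℂ} {z : ℂ}
    (h : HasW F a b z) (i : Fin m) : HasW (fun w => F w i) (a i) (b i) z :=
  h.clm (ContinuousLinearMap.proj (R := ℂ) (φ := fun _ : Fin m => ℂ) i)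

theorem HasW.vconj {m : ℕ} {F : ℂ → Fin m → ℂ} {a b : Fin m → ℂ} {z : ℂ} (h : HasW F a b z) :
    HasW (fun w => vconj (F w)) (vconj b) (vconj a) z :=
  hasW_of_pi fun i => (h.apply i).conjugate

/-- The complex Minkowski form as a continuous bilinear map. -/
def minkCLM {m : ℕ} : (Fin (m + 1) → ℂ) →L[ℂ] (Fin (m + 1) → ℂ) →L[ℂ] ℂ :=
  (minkBilin (R := ℂ)).toContinuousBilinearMap

theorem HasW.mink {m : ℕ} {F G : ℂ → Fin (m + 1) → ℂ} {a b c d : Fin (m + 1) → ℂ} {z : ℂ}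
    (hF : HasW F a b z) (hG : HasW G c d z) :
    HasW (fun w => mink (F w) (G w)) (mink a (G z) + mink (F z) c)
      (mink b (G z) + mink (F z) d) z :=
  hF.bilin hG minkCLM

/-! ### Smooth functions -/

namespace SmoothOn

variable {Ω : Set ℂ}

theorem hasW {F : ℂ → W} (h : SmoothOn F Ω) (hΩ : IsOpen Ω) {z : ℂ} (hz : z ∈ Ω) :
    HasW F (dz F z) (dzbar F z) z :=
  ⟨(ContDiffOn.contDiffAt h (hΩ.mem_nhds hz)).differentiableAt (by simp), rfl, rfl⟩

theorem congr {F G : ℂ → W} (h : SmoothOn F Ω) (hFG : ∀ w ∈ Ω, G w = F w) : SmoothOn G Ω :=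
  ContDiffOn.congr h hFG

theorem fderiv_apply {F : ℂ → W} (h : SmoothOn F Ω) (hΩ : IsOpen Ω) (v : ℂ) :
    SmoothOn (fun z => fderiv ℝ F z v) Ω := by
  have h1 : ContDiffOn ℝ ∞ (fderiv ℝ F) Ω := ContDiffOn.fderiv_of_isOpen h hΩ (by simp)
  exact h1.clm_apply contDiffOn_const

theorem const (c : W) : SmoothOn (fun _ => c) Ω := contDiffOn_const

theorem add {F G : ℂ → W} (hF : SmoothOn F Ω) (hG : SmoothOn G Ω) :
    SmoothOn (fun w => F w + G w) Ω := ContDiffOn.add hF hG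

theorem sub {F G : ℂ → W} (hF : SmoothOn F Ω) (hG : SmoothOn G Ω) :
    SmoothOn (fun w => F w - G w) Ω := ContDiffOn.sub hF hG

theorem clm {F : ℂ → W₁} (hF : SmoothOn F Ω) (L : W₁ →L[ℂ] W₂) :
    SmoothOn (fun w => L (F w)) Ω :=
  (L.restrictScalars ℝ).contDiff.comp_contDiffOn hF

theorem bilin {F : ℂ → W₁} {G : ℂ → W₂} (hF : SmoothOn F Ω) (hG : SmoothOn G Ω)
    (B : W₁ →L[ℂ] W₂ →L[ℂ] W₃) : SmoothOn (fun w => B (F w) (G w)) Ω := by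
  have h1 : SmoothOn (fun w => (ContinuousLinearMap.restrictScalarsL ℂ W₂ W₃ ℝ ℝ) (B (F w))) Ω :=
    ((ContinuousLinearMap.restrictScalarsL ℂ W₂ W₃ ℝ ℝ).comp
      (B.restrictScalars ℝ)).contDiff.comp_contDiffOn hF
  exact ContDiffOn.clm_apply h1 hG

theorem smul {F : ℂ → ℂ} {G : ℂ → W} (hF : SmoothOn F Ω) (hG : SmoothOn G Ω) :
    SmoothOn (fun w => F w • G w) Ω := hF.bilin hG (ContinuousLinearMap.lsmul ℂ ℂ)

theorem mul {F G : ℂ → ℂ} (hF : SmoothOn F Ω) (hG : SmoothOn G Ω) :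
    SmoothOn (fun w => F w * G w) Ω := hF.smul hG

theorem const_smul {G : ℂ → W} (c : ℂ) (hG : SmoothOn G Ω) :
    SmoothOn (fun w => c • G w) Ω := (const c).smul hG

theorem inv {F : ℂ → ℂ} (hF : SmoothOn F Ω) (h0 : ∀ z ∈ Ω, F z ≠ 0) :
    SmoothOn (fun w => (F w)⁻¹) Ω := ContDiffOn.inv hF h0

theorem conjugate {F : ℂ → ℂ} (hF : SmoothOn F Ω) : SmoothOn (fun w => conj (F w)) Ω :=
  (Complex.conjCLE : ℂ →L[ℝ] ℂ).contDiff.comp_contDiffOn hF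

theorem dz {F : ℂ → W} (hF : SmoothOn F Ω) (hΩ : IsOpen Ω) : SmoothOn (dz F) Ω :=
  ((hF.fderiv_apply hΩ 1).sub ((hF.fderiv_apply hΩ Complex.I).const_smul _)).const_smul _

theorem dzbar {F : ℂ → W} (hF : SmoothOn F Ω) (hΩ : IsOpen Ω) : SmoothOn (dzbar F) Ω :=
  ((hF.fderiv_apply hΩ 1).add ((hF.fderiv_apply hΩ Complex.I).const_smul _)).const_smul _

theorem of_pi {m : ℕ} {F : ℂ → Fin m → ℂ} (h : ∀ i, SmoothOn (fun w => F w i) Ω) :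
    SmoothOn F Ω := contDiffOn_pi.2 h

theorem apply {m : ℕ} {F : ℂ → Fin m → ℂ} (h : SmoothOn F Ω) (i : Fin m) :
    SmoothOn (fun w => F w i) Ω := contDiffOn_pi.1 h i

theorem vconj {m : ℕ} {F : ℂ → Fin m → ℂ} (h : SmoothOn F Ω) :
    SmoothOn (fun w => vconj (F w)) Ω := of_pi fun i => (h.apply i).conjugate

theorem mink {m : ℕ} {F G : ℂ → Fin (m + 1) → ℂ} (hF : SmoothOn F Ω) (hG : SmoothOn G Ω) :
    SmoothOn (fun w => mink (F w) (G w)) Ω := hF.bilin hG minkCLM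

theorem ofReal {g : ℂ → ℝ} (hg : ContDiffOn ℝ ∞ g Ω) : SmoothOn (fun w => (g w : ℂ)) Ω :=
  Complex.ofRealCLM.contDiff.comp_contDiffOn hg

theorem re {F : ℂ → ℂ} (hF : SmoothOn F Ω) : ContDiffOn ℝ ∞ (fun w => (F w).re) Ω :=
  Complex.reCLM.contDiff.comp_contDiffOn hF

theorem dz_dzbar_comm {F : ℂ → W} (hF : SmoothOn F Ω) (hΩ : IsOpen Ω) {z : ℂ} (hz : z ∈ Ω) :
    MoebiusSurface.dz (MoebiusSurface.dzbar F) z = MoebiusSurface.dzbar (MoebiusSurface.dz F) z := by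
  have hc : ContDiffAt ℝ ∞ F z := ContDiffOn.contDiffAt hF (hΩ.mem_nhds hz)
  have hs : IsSymmSndFDerivAt ℝ F z := hc.isSymmSndFDerivAt
    (by simpa using WithTop.coe_le_coe.2 (le_top : (2 : ℕ∞) ≤ ⊤))
  have hd : DifferentiableAt ℝ (fderiv ℝ F) z :=
    (hc.fderiv_right (m := ∞) (by simp)).differentiableAt (by simp)
  have key : ∀ v w, fderiv ℝ (fun u => fderiv ℝ F u v) z w = fderiv ℝ (fderiv ℝ F) z w v := by
    intro v w
    have := hd.hasFDerivAt.clm_apply (hasFDerivAt_const v z)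
    rw [this.fderiv]; simp
  have hx := (hF.fderiv_apply hΩ 1).hasW hΩ hz
  have hy := (hF.fderiv_apply hΩ Complex.I).hasW hΩ hz
  have e1 := ((hx.add (hy.const_smul Complex.I)).const_smul (1 / 2)).2.1
  have e2 := ((hx.sub (hy.const_smul Complex.I)).const_smul (1 / 2)).2.2
  have e1' : MoebiusSurface.dz (MoebiusSurface.dzbar F) z = _ := e1
  have e2' : MoebiusSurface.dzbar (MoebiusSurface.dz F) z = _ := e2
  rw [e1', e2']
  simp only [MoebiusSurface.dz, MoebiusSurface.dzbar, key, hs.eq 1 Complex.I]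
  module

end SmoothOn

end Calculus

/-! ### The canonical lift of a conformal immersion -/

/-- `f` is a conformal immersion of the open set `Ω ⊆ ℂ` into the unit sphere of `ℝ^(n+1)`. -/
structure ConfOn {n : ℕ} (f : ℂ → EuclideanSpace ℝ (Fin (n + 1))) (Ω : Set ℂ) : Prop where
  isOpen : IsOpen Ω
  smooth : ContDiffOn ℝ ∞ f Ω
  norm : ∀ z ∈ Ω, ‖f z‖ = 1
  immersion : ∀ z ∈ Ω, fderiv ℝ f z 1 ≠ 0
  norm_eq : ∀ z ∈ Ω, ‖fderiv ℝ f z Complex.I‖ = ‖fderiv ℝ f z 1‖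
  orthogonal : ∀ z ∈ Ω, inner ℝ (fderiv ℝ f z 1) (fderiv ℝ f z Complex.I) = 0

theorem inner_eq_sum {m : ℕ} (x y : EuclideanSpace ℝ (Fin m)) :
    inner ℝ x y = ∑ i, x i * y i := by
  simp [PiLp.inner_apply, mul_comm]

theorem lift_apply {n : ℕ} (f : ℂ → EuclideanSpace ℝ (Fin (n + 1))) (z : ℂ) (i : Fin (n + 2)) :
    lift f z i = (nullLift (f z) i : ℂ) := rfl

theorem nullLift_zero {m : ℕ} (x : EuclideanSpace ℝ (Fin m)) : nullLift x 0 = 1 := rfl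

theorem nullLift_succ {m : ℕ} (x : EuclideanSpace ℝ (Fin m)) (i : Fin m) :
    nullLift x i.succ = x i := rfl

theorem vconj_lift {n : ℕ} (f : ℂ → EuclideanSpace ℝ (Fin (n + 1))) (z : ℂ) :
    vconj (lift f z) = lift f z := by
  funext i; simp [vconj, lift_apply]

theorem hasW_ofReal_apply {m : ℕ} {f : ℂ → EuclideanSpace ℝ (Fin m)} {z : ℂ}
    (hf : DifferentiableAt ℝ f z) (i : Fin m) :
    HasW (fun w => ((f w i : ℝ) : ℂ))
      ((1 / 2) * ((fderiv ℝ f z 1 i : ℂ) - Complex.I * (fderiv ℝ f z Complex.I i : ℂ)))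
      ((1 / 2) * ((fderiv ℝ f z 1 i : ℂ) + Complex.I * (fderiv ℝ f z Complex.I i : ℂ))) z := by
  have h1 : HasFDerivAt (fun w => ((f w i : ℝ) : ℂ)) _ z :=
    (Complex.ofRealCLM.comp (EuclideanSpace.proj i : _ →L[ℝ] ℝ)).hasFDerivAt.comp z hf.hasFDerivAt
  refine ⟨h1.differentiableAt, ?_, ?_⟩
  · simp [dz, h1.fderiv]
  · simp [dzbar, h1.fderiv]

theorem dzbar_eq_vconj_dz {m : ℕ} {Ω : Set ℂ} (hΩ : IsOpen Ω) {F : ℂ → Fin m → ℂ}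
    (hF : SmoothOn F Ω) (hr : ∀ z ∈ Ω, vconj (F z) = F z) {z : ℂ} (hz : z ∈ Ω) :
    dzbar F z = vconj (dz F z) :=
  ((hF.hasW hΩ hz).unique ((hF.hasW hΩ hz).vconj.congr hΩ hz fun w hw => (hr w hw).symm)).2

theorem dzbar_vconj {m : ℕ} {Ω : Set ℂ} (hΩ : IsOpen Ω) {F G : ℂ → Fin m → ℂ}
    (hF : SmoothOn F Ω) (hr : ∀ z ∈ Ω, G z = vconj (F z)) {z : ℂ} (hz : z ∈ Ω) :
    dzbar G z = vconj (dz F z) ∧ dz G z = vconj (dzbar F z) :=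
  have h := (hF.hasW hΩ hz).vconj.congr hΩ hz hr
  ⟨h.2.2, h.2.1⟩

/-- The scale factor of the canonical lift. -/
def scale {n : ℕ} (f : ℂ → EuclideanSpace ℝ (Fin (n + 1))) (z : ℂ) : ℝ :=
  (Real.sqrt (2 * (mink (dz (lift f) z) (dzbar (lift f) z)).re))⁻¹

/-- The Schwarzian `s`. -/
def schw {n : ℕ} (f : ℂ → EuclideanSpace ℝ (Fin (n + 1))) (z : ℂ) : ℂ :=
  2 * mink (dz (dz (Y f)) z) (N f z)

namespace ConfOn

variable {n : ℕ} {f : ℂ → EuclideanSpace ℝ (Fin (n + 1))} {Ω : Set ℂ} {z : ℂ}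

theorem differentiableAt (hf : ConfOn f Ω) (hz : z ∈ Ω) : DifferentiableAt ℝ f z :=
  (hf.smooth.contDiffAt (hf.isOpen.mem_nhds hz)).differentiableAt (by simp)

theorem smoothOn_lift (hf : ConfOn f Ω) : SmoothOn (lift f) Ω := by
  refine SmoothOn.of_pi fun i => ?_
  refine Fin.cases ?_ (fun j => ?_) i
  · exact SmoothOn.const ((1 : ℝ) : ℂ)
  · exact SmoothOn.ofReal ((EuclideanSpace.proj j : _ →L[ℝ] ℝ).contDiff.comp_contDiffOn hf.smooth)

theorem hasW_lift (hf : ConfOn f Ω) (hz : z ∈ Ω) :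
    HasW (lift f)
      (Fin.cons 0 fun i => (1 / 2) *
        ((fderiv ℝ f z 1 i : ℂ) - Complex.I * (fderiv ℝ f z Complex.I i : ℂ)))
      (Fin.cons 0 fun i => (1 / 2) *
        ((fderiv ℝ f z 1 i : ℂ) + Complex.I * (fderiv ℝ f z Complex.I i : ℂ))) z := by
  refine hasW_of_pi fun i => ?_
  refine Fin.cases ?_ (fun j => ?_) i
  · exact hasW_const ((1 : ℝ) : ℂ) z
  · exact hasW_ofReal_apply (hf.differentiableAt hz) j

theorem lift_lift (hf : ConfOn f Ω) (hz : z ∈ Ω) : mink (lift f z) (lift f z) = 0 := by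
  have h : ∑ i, f z i * f z i = 1 := by
    rw [← inner_eq_sum, real_inner_self_eq_norm_sq, hf.norm z hz, one_pow]
  have h' := congrArg (fun t : ℝ => (t : ℂ)) h
  push_cast at h'
  simp only [mink, lift_apply, nullLift_zero, nullLift_succ, h']
  simp

theorem sum_sq (hf : ConfOn f Ω) (hz : z ∈ Ω) :
    (∑ i, (fderiv ℝ f z Complex.I i : ℂ) * fderiv ℝ f z Complex.I i) =
      ∑ i, (fderiv ℝ f z 1 i : ℂ) * fderiv ℝ f z 1 i := by
  have h := hf.norm_eq z hz
  have h2 : inner ℝ (fderiv ℝ f z Complex.I) (fderiv ℝ f z Complex.I) =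
      inner ℝ (fderiv ℝ f z 1) (fderiv ℝ f z 1) := by
    rw [real_inner_self_eq_norm_sq, real_inner_self_eq_norm_sq, h]
  rw [inner_eq_sum, inner_eq_sum] at h2
  exact_mod_cast h2

theorem liftz_liftz (hf : ConfOn f Ω) (hz : z ∈ Ω) :
    mink (dz (lift f) z) (dz (lift f) z) = 0 := by
  have h1 := hf.sum_sq hz
  have h2 := hf.orthogonal z hz
  rw [inner_eq_sum] at h2
  have h3 := congrArg (fun t : ℝ => (t : ℂ)) h2
  push_cast at h3
  rw [(hf.hasW_lift hz).2.1]
  simp only [mink, Fin.cons_zero, Fin.cons_succ]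
  have e : ∀ i : Fin (n + 1), (1 / 2 : ℂ) * ((fderiv ℝ f z 1 i : ℂ) - Complex.I *
      (fderiv ℝ f z Complex.I i : ℂ)) * ((1 / 2) * ((fderiv ℝ f z 1 i : ℂ) - Complex.I *
      (fderiv ℝ f z Complex.I i : ℂ))) = (1 / 4) * ((fderiv ℝ f z 1 i : ℂ) * fderiv ℝ f z 1 i)
      - (1 / 4) * ((fderiv ℝ f z Complex.I i : ℂ) * fderiv ℝ f z Complex.I i)
      - (Complex.I / 2) * ((fderiv ℝ f z 1 i : ℂ) * fderiv ℝ f z Complex.I i) := by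
    intro i
    linear_combination (1 / 4 : ℂ) * (fderiv ℝ f z Complex.I i : ℂ) ^ 2 * Complex.I_mul_I
  simp only [e, Finset.sum_sub_distrib, ← Finset.mul_sum, h1, h3]
  ring

theorem liftz_liftzb (hf : ConfOn f Ω) (hz : z ∈ Ω) :
    mink (dz (lift f) z) (dzbar (lift f) z) = ((‖fderiv ℝ f z 1‖ ^ 2 / 2 : ℝ) : ℂ) := by
  have h1 := hf.sum_sq hz
  have h2 : ‖fderiv ℝ f z 1‖ ^ 2 = ∑ i, fderiv ℝ f z 1 i * fderiv ℝ f z 1 i := by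
    rw [← inner_eq_sum, real_inner_self_eq_norm_sq]
  rw [(hf.hasW_lift hz).2.1, (hf.hasW_lift hz).2.2]
  simp only [mink, Fin.cons_zero, Fin.cons_succ]
  have e : ∀ i : Fin (n + 1), (1 / 2 : ℂ) * ((fderiv ℝ f z 1 i : ℂ) - Complex.I *
      (fderiv ℝ f z Complex.I i : ℂ)) * ((1 / 2) * ((fderiv ℝ f z 1 i : ℂ) + Complex.I *
      (fderiv ℝ f z Complex.I i : ℂ))) = (1 / 4) * ((fderiv ℝ f z 1 i : ℂ) * fderiv ℝ f z 1 i)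
      + (1 / 4) * ((fderiv ℝ f z Complex.I i : ℂ) * fderiv ℝ f z Complex.I i) := by
    intro i
    linear_combination -(1 / 4 : ℂ) * (fderiv ℝ f z Complex.I i : ℂ) ^ 2 * Complex.I_mul_I
  simp only [e, Finset.sum_add_distrib, ← Finset.mul_sum, h1]
  rw [h2]
  push_cast
  ring

theorem Y_eq (f : ℂ → EuclideanSpace ℝ (Fin (n + 1))) (z : ℂ) :
    Y f z = (scale f z : ℂ) • lift f z := rfl

theorem re_pos (hf : ConfOn f Ω) (hz : z ∈ Ω) :
    0 < 2 * (mink (dz (lift f) z) (dzbar (lift f) z)).re := by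
  have h := norm_pos_iff.2 (hf.immersion z hz)
  rw [hf.liftz_liftzb hz, Complex.ofReal_re]
  positivity

theorem scale_pos (hf : ConfOn f Ω) (hz : z ∈ Ω) : 0 < scale f z :=
  inv_pos.2 (Real.sqrt_pos.2 (hf.re_pos hz))

theorem scale_sq (hf : ConfOn f Ω) (hz : z ∈ Ω) :
    (scale f z : ℂ) ^ 2 * mink (dz (lift f) z) (dzbar (lift f) z) = 1 / 2 := by
  have h1 := hf.re_pos hz
  have h2 : scale f z ^ 2 * (2 * (mink (dz (lift f) z) (dzbar (lift f) z)).re) = 1 := by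
    rw [scale, inv_pow, Real.sq_sqrt h1.le, inv_mul_cancel₀ h1.ne']
  rw [hf.liftz_liftzb hz, Complex.ofReal_re] at h2
  rw [hf.liftz_liftzb hz]
  norm_cast
  push_cast
  have h3 := congrArg (fun t : ℝ => (t : ℂ)) h2
  push_cast at h3
  linear_combination h3 / 2

theorem smoothOn_scale (hf : ConfOn f Ω) : SmoothOn (fun z => (scale f z : ℂ)) Ω := by
  have hl := hf.smoothOn_lift
  refine SmoothOn.ofReal (ContDiffOn.inv (ContDiffOn.sqrt (contDiffOn_const.mul
    ((hl.dz hf.isOpen).mink (hl.dzbar hf.isOpen)).re) ?_) ?_)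
  · exact fun z hz => (hf.re_pos hz).ne'
  · exact fun z hz => (Real.sqrt_pos.2 (hf.re_pos hz)).ne'

theorem smoothOn_Y (hf : ConfOn f Ω) : SmoothOn (Y f) Ω :=
  hf.smoothOn_scale.smul hf.smoothOn_lift

theorem vconj_Y (f : ℂ → EuclideanSpace ℝ (Fin (n + 1))) (z : ℂ) : vconj (Y f z) = Y f z := by
  rw [Y_eq, vconj_smul, vconj_lift, Complex.conj_ofReal]

theorem Y_Y (hf : ConfOn f Ω) (hz : z ∈ Ω) : mink (Y f z) (Y f z) = 0 := by
  rw [Y_eq, mink_smul_left, mink_smul_right, hf.lift_lift hz]; ring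

theorem hasW_Y (hf : ConfOn f Ω) (hz : z ∈ Ω) : HasW (Y f) (dz (Y f) z) (dzbar (Y f) z) z :=
  hf.smoothOn_Y.hasW hf.isOpen hz

theorem lift_liftz (hf : ConfOn f Ω) (hz : z ∈ Ω) :
    mink (lift f z) (dz (lift f) z) = 0 ∧ mink (lift f z) (dzbar (lift f) z) = 0 := by
  have hl := hf.smoothOn_lift.hasW hf.isOpen hz
  have h := ((hl.mink hl).unique ((hasW_const 0 z).congr hf.isOpen hz fun w hw => hf.lift_lift hw))
  simp only [mink_comm _ (lift f z)] at h
  exact ⟨by linear_combination h.1 / 2, by linear_combination h.2 / 2⟩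

theorem Yz_Yz (hf : ConfOn f Ω) (hz : z ∈ Ω) : mink (dz (Y f) z) (dz (Y f) z) = 0 := by
  have h := ((hf.smoothOn_scale.hasW hf.isOpen hz).smul (hf.smoothOn_lift.hasW hf.isOpen hz)).2.1
  have h' : dz (Y f) z = _ := h
  rw [h']
  simp only [mink_add_left, mink_add_right, mink_smul_left, mink_smul_right,
    mink_comm (dz (lift f) z) (lift f z), hf.lift_lift hz, (hf.lift_liftz hz).1, hf.liftz_liftz hz]
  ring

theorem Yz_Yzb (hf : ConfOn f Ω) (hz : z ∈ Ω) : mink (dz (Y f) z) (dzbar (Y f) z) = 1 / 2 := by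
  have h := ((hf.smoothOn_scale.hasW hf.isOpen hz).smul (hf.smoothOn_lift.hasW hf.isOpen hz))
  have h1 : dz (Y f) z = _ := h.2.1
  have h2 : dzbar (Y f) z = _ := h.2.2
  rw [h1, h2]
  simp only [mink_add_left, mink_add_right, mink_smul_left, mink_smul_right,
    mink_comm (dz (lift f) z) (lift f z), hf.lift_lift hz, (hf.lift_liftz hz).1,
    (hf.lift_liftz hz).2]
  linear_combination hf.scale_sq hz

-- Conjugation exchanges the two Wirtinger derivatives and fixes the real lift.
theorem dzbar_Y (hf : ConfOn f Ω) (hz : z ∈ Ω) : dzbar (Y f) z = vconj (dz (Y f) z) :=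
  dzbar_eq_vconj_dz hf.isOpen hf.smoothOn_Y (fun w _ => vconj_Y f w) hz

theorem smoothOn_Yz (hf : ConfOn f Ω) : SmoothOn (dz (Y f)) Ω := hf.smoothOn_Y.dz hf.isOpen

theorem smoothOn_Yzb (hf : ConfOn f Ω) : SmoothOn (dzbar (Y f)) Ω := hf.smoothOn_Y.dzbar hf.isOpen

theorem smoothOn_Yzz (hf : ConfOn f Ω) : SmoothOn (dz (dz (Y f))) Ω := hf.smoothOn_Yz.dz hf.isOpen

theorem smoothOn_Yzzb (hf : ConfOn f Ω) : SmoothOn (dzbar (dz (Y f))) Ω :=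
  hf.smoothOn_Yz.dzbar hf.isOpen

theorem hasW_Yz (hf : ConfOn f Ω) (hz : z ∈ Ω) :
    HasW (dz (Y f)) (dz (dz (Y f)) z) (dzbar (dz (Y f)) z) z := hf.smoothOn_Yz.hasW hf.isOpen hz

theorem dzbar_Yzb (hf : ConfOn f Ω) (hz : z ∈ Ω) :
    dzbar (dzbar (Y f)) z = vconj (dz (dz (Y f)) z) :=
  (dzbar_vconj hf.isOpen hf.smoothOn_Yz (fun _ hw => hf.dzbar_Y hw) hz).1

theorem hasW_Yzb (hf : ConfOn f Ω) (hz : z ∈ Ω) :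
    HasW (dzbar (Y f)) (dzbar (dz (Y f)) z) (vconj (dz (dz (Y f)) z)) z := by
  have h := hf.smoothOn_Yzb.hasW hf.isOpen hz
  rwa [hf.smoothOn_Y.dz_dzbar_comm hf.isOpen hz, hf.dzbar_Yzb hz] at h

theorem vconj_Yzzb (hf : ConfOn f Ω) (hz : z ∈ Ω) :
    vconj (dzbar (dz (Y f)) z) = dzbar (dz (Y f)) z := by
  rw [← (dzbar_vconj hf.isOpen hf.smoothOn_Yz (fun _ hw => hf.dzbar_Y hw) hz).2,
    hf.smoothOn_Y.dz_dzbar_comm hf.isOpen hz]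

/-! Inner products of the derivatives of `Y`. -/

theorem Y_Yz (hf : ConfOn f Ω) (hz : z ∈ Ω) :
    mink (Y f z) (dz (Y f) z) = 0 ∧ mink (Y f z) (dzbar (Y f) z) = 0 := by
  have hl := hf.hasW_Y hz
  have h := ((hl.mink hl).unique ((hasW_const 0 z).congr hf.isOpen hz fun w hw => hf.Y_Y hw))
  simp only [mink_comm _ (Y f z)] at h
  exact ⟨by linear_combination h.1 / 2, by linear_combination h.2 / 2⟩

theorem Yz_Yzz (hf : ConfOn f Ω) (hz : z ∈ Ω) :
    mink (dz (Y f) z) (dz (dz (Y f)) z) = 0 ∧ mink (dz (Y f) z) (dzbar (dz (Y f)) z) = 0 := by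
  have hl := hf.hasW_Yz hz
  have h := ((hl.mink hl).unique ((hasW_const 0 z).congr hf.isOpen hz fun w hw => hf.Yz_Yz hw))
  simp only [mink_comm _ (dz (Y f) z)] at h
  exact ⟨by linear_combination h.1 / 2, by linear_combination h.2 / 2⟩

theorem Yzb_Yzzb (hf : ConfOn f Ω) (hz : z ∈ Ω) :
    mink (dzbar (Y f) z) (dzbar (dz (Y f)) z) = 0 := by
  rw [hf.dzbar_Y hz, ← hf.vconj_Yzzb hz, mink_vconj, (hf.Yz_Yzz hz).2, map_zero]

theorem Y_Yzz (hf : ConfOn f Ω) (hz : z ∈ Ω) :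
    mink (Y f z) (dz (dz (Y f)) z) = 0 ∧ mink (Y f z) (dzbar (dz (Y f)) z) = -(1 / 2) := by
  have h := (((hf.hasW_Y hz).mink (hf.hasW_Yz hz)).unique
    ((hasW_const 0 z).congr hf.isOpen hz fun w hw => (hf.Y_Yz hw).1))
  rw [hf.Yz_Yz hz, mink_comm (dzbar (Y f) z), hf.Yz_Yzb hz] at h
  exact ⟨by linear_combination h.1, by linear_combination h.2⟩

/-- The normalization of the lift enters here: ⟨Y_z, Y_z̄⟩ is constant, and the other term of its
z-derivative is ⟨Y_z, Y_zz̄⟩ = 0. -/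
theorem Yzz_Yzb (hf : ConfOn f Ω) (hz : z ∈ Ω) :
    mink (dz (dz (Y f)) z) (dzbar (Y f) z) = 0 := by
  have h := (((hf.hasW_Yz hz).mink (hf.hasW_Yzb hz)).unique
    ((hasW_const (1 / 2) z).congr hf.isOpen hz fun w hw => hf.Yz_Yzb hw)).1
  rw [(hf.Yz_Yzz hz).2] at h
  linear_combination h

theorem smoothOn_N (hf : ConfOn f Ω) : SmoothOn (N f) Ω :=
  (hf.smoothOn_Yzzb.const_smul 2).add
    ((((SmoothOn.const 2).mul (hf.smoothOn_Yzzb.mink hf.smoothOn_Yzzb))).smul hf.smoothOn_Y)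

theorem vconj_N (hf : ConfOn f Ω) (hz : z ∈ Ω) : vconj (N f z) = N f z := by
  have h : conj (mink (dzbar (dz (Y f)) z) (dzbar (dz (Y f)) z)) =
      mink (dzbar (dz (Y f)) z) (dzbar (dz (Y f)) z) := by
    rw [← mink_vconj, hf.vconj_Yzzb hz]
  rw [N, vconj_add, vconj_smul, vconj_smul, hf.vconj_Yzzb hz, vconj_Y, map_mul, h,
    Complex.conj_ofNat]

theorem N_Y (hf : ConfOn f Ω) (hz : z ∈ Ω) : mink (N f z) (Y f z) = -1 := by
  rw [N, mink_add_left, mink_smul_left, mink_smul_left, hf.Y_Y hz, mink_comm _ (Y f z),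
    (hf.Y_Yzz hz).2]
  norm_num

theorem N_N (hf : ConfOn f Ω) (hz : z ∈ Ω) : mink (N f z) (N f z) = 0 := by
  have h1 := (hf.Y_Yzz hz).2
  have h2 := h1
  rw [mink_comm] at h2
  rw [N]
  simp only [mink_add_left, mink_add_right, mink_smul_left, mink_smul_right, hf.Y_Y hz, h1, h2]
  ring

theorem N_Yz (hf : ConfOn f Ω) (hz : z ∈ Ω) : mink (N f z) (dz (Y f) z) = 0 := by
  have h1 := (hf.Yz_Yzz hz).2
  rw [mink_comm] at h1
  rw [N, mink_add_left, mink_smul_left, mink_smul_left, (hf.Y_Yz hz).1, h1]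
  ring

theorem N_Yzb (hf : ConfOn f Ω) (hz : z ∈ Ω) : mink (N f z) (dzbar (Y f) z) = 0 := by
  rw [hf.dzbar_Y hz, ← hf.vconj_N hz, mink_vconj, hf.N_Yz hz, map_zero]

/-- The normal projection annihilates `V`, and its image is orthogonal to `V`. -/
theorem nproj_orth (hf : ConfOn f Ω) (hz : z ∈ Ω) (X : Fin (n + 2) → ℂ) :
    mink (nproj f z X) (Y f z) = 0 ∧ mink (nproj f z X) (dz (Y f) z) = 0 ∧
      mink (nproj f z X) (dzbar (Y f) z) = 0 ∧ mink (nproj f z X) (N f z) = 0 := by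
  have a1 := hf.Y_Y hz
  have a2 := (hf.Y_Yz hz).1
  have a3 := (hf.Y_Yz hz).2
  have a4 := hf.Yz_Yz hz
  have a5 := hf.Yz_Yzb hz
  have a6 : mink (dzbar (Y f) z) (dzbar (Y f) z) = 0 := by
    rw [hf.dzbar_Y hz, mink_vconj, a4, map_zero]
  have a7 := hf.N_Y hz
  have a8 := hf.N_N hz
  have a9 := hf.N_Yz hz
  have a10 := hf.N_Yzb hz
  have b7 := a7; rw [mink_comm] at b7
  have b9 := a9; rw [mink_comm] at b9
  have b10 := a10; rw [mink_comm] at b10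
  have b2 := a2; rw [mink_comm] at b2
  have b3 := a3; rw [mink_comm] at b3
  have b5 := a5; rw [mink_comm] at b5
  simp only [nproj, mink_add_left, mink_sub_left, mink_smul_left, a1, a2, a3, a4, a5, a6, a7, a8,
    a9, a10, b7, b9, b10, b2, b3, b5]
  refine ⟨?_, ?_, ?_, ?_⟩ <;> ring

theorem kappa_orth (hf : ConfOn f Ω) (hz : z ∈ Ω) :
    mink (kappa f z) (Y f z) = 0 ∧ mink (kappa f z) (dz (Y f) z) = 0 ∧
      mink (kappa f z) (dzbar (Y f) z) = 0 ∧ mink (kappa f z) (N f z) = 0 :=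
  hf.nproj_orth hz _

theorem smoothOn_schw (hf : ConfOn f Ω) : SmoothOn (schw f) Ω :=
  (SmoothOn.const 2).mul (hf.smoothOn_Yzz.mink hf.smoothOn_N)

/-- Since Y_zz is orthogonal to Y, Y_z and Y_z̄, its V-part is a multiple of Y; the coefficient is
read off by N because ⟨Y, N⟩ = -1. -/
theorem kappa_eq (hf : ConfOn f Ω) (hz : z ∈ Ω) :
    kappa f z = dz (dz (Y f)) z + (schw f z / 2) • Y f z := by
  rw [kappa, nproj, hf.Yzz_Yzb hz, mink_comm _ (Y f z), (hf.Y_Yzz hz).1, mink_comm _ (dz (Y f) z),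
    (hf.Yz_Yzz hz).1, schw]
  module

theorem smoothOn_kappa (hf : ConfOn f Ω) : SmoothOn (kappa f) Ω :=
  (hf.smoothOn_Yzz.add (((hf.smoothOn_schw.const_smul (1 / 2)).smul hf.smoothOn_Y))).congr
    fun w hw => by rw [hf.kappa_eq hw]; congr 2; simp; ring

/-- The projection changes X only by elements of V, which K does not see. This permits replacing
D_z̄ κ by the plain derivative when pairing with κ̄. -/
theorem mink_nproj {X K : Fin (n + 2) → ℂ}
    (h1 : mink K (Y f z) = 0) (h2 : mink K (dz (Y f) z) = 0)
    (h3 : mink K (dzbar (Y f) z) = 0) (h4 : mink K (N f z) = 0) :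
    mink (nproj f z X) K = mink X K := by
  rw [mink_comm] at h1 h2 h3 h4
  simp only [nproj, mink_add_left, mink_sub_left, mink_smul_left, h1, h2, h3, h4]
  ring

theorem vconj_kappa_orth (hf : ConfOn f Ω) (hz : z ∈ Ω) :
    mink (vconj (kappa f z)) (Y f z) = 0 ∧ mink (vconj (kappa f z)) (dz (Y f) z) = 0 ∧
      mink (vconj (kappa f z)) (dzbar (Y f) z) = 0 ∧ mink (vconj (kappa f z)) (N f z) = 0 := by
  obtain ⟨h1, h2, h3, h4⟩ := hf.kappa_orth hz
  refine ⟨?_, ?_, ?_, ?_⟩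
  · rw [← vconj_Y, mink_vconj, h1, map_zero]
  · rw [← vconj_vconj (dz (Y f) z), ← hf.dzbar_Y hz, mink_vconj, h3, map_zero]
  · rw [hf.dzbar_Y hz, mink_vconj, h2, map_zero]
  · rw [← hf.vconj_N hz, mink_vconj, h4, map_zero]

theorem kappaSq_conj (f : ℂ → EuclideanSpace ℝ (Fin (n + 1))) (z : ℂ) :
    conj (kappaSq f z) = kappaSq f z := by
  rw [kappaSq, ← mink_vconj, vconj_vconj, mink_comm]

end ConfOn

/-! ### Structure equations of isotropic surfaces without umbilic points -/

/-- Biorthogonality makes the v j independent, and n independent vectors span ℂⁿ. It serves both the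
moving frame in ℂ⁶ and the splitting of ℂ⁴ into conjugate isotropic planes. -/
theorem eq_sum_of_biorthogonal {n : ℕ} (v : Fin n → Fin n → ℂ) (φ : Fin n → (Fin n → ℂ) →ₗ[ℂ] ℂ)
    (h : ∀ i j, φ i (v j) = if i = j then 1 else 0) (X : Fin n → ℂ) : X = ∑ i, φ i X • v i := by
  have hli : LinearIndependent ℂ v := by
    rw [Fintype.linearIndependent_iff]
    intro g hg i
    have := congrArg (φ i) hg
    simpa [map_sum, h] using this
  have hspan : X ∈ Submodule.span ℂ (Set.range v) := by
    rw [hli.span_eq_top_of_card_eq_finrank' (by simp)]; trivial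
  obtain ⟨c, hc⟩ := (Submodule.mem_span_range_iff_exists_fun ℂ).1 hspan
  have hφ : ∀ i, c i = φ i X := by
    intro i
    rw [← hc]
    simp [map_sum, h]
  simp only [← hφ, hc]

/-- On `Ω`, the surface is isotropic without umbilic points. -/
structure IsoOn {n : ℕ} (f : ℂ → EuclideanSpace ℝ (Fin (n + 1))) (Ω : Set ℂ) : Prop
    extends ConfOn f Ω where
  iso : ∀ z ∈ Ω, mink (kappa f z) (kappa f z) = 0
  umb : ∀ z ∈ Ω, kappa f z ≠ 0

namespace ConfOn

variable {n : ℕ} {f : ℂ → EuclideanSpace ℝ (Fin (n + 1))} {Ω : Set ℂ} {z : ℂ}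

/-- Subtracting X₀ (1, f), which is null and orthogonal to X, removes the time component without
changing ⟨X, X̄⟩. Hence the Hermitian form is nonnegative on Y^⊥. -/
theorem mink_vconj_eq_sum (hf : ConfOn f Ω) (hz : z ∈ Ω) {X : Fin (n + 2) → ℂ}
    (hX : mink X (Y f z) = 0) :
    mink X (vconj X) = ((∑ i : Fin (n + 1), ‖X i.succ - X 0 * (f z i : ℂ)‖ ^ 2 : ℝ) : ℂ) := by
  have hs : (scale f z : ℂ) ≠ 0 := Complex.ofReal_ne_zero.2 (hf.scale_pos hz).ne'
  have h1 : mink X (lift f z) = 0 := by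
    rw [Y_eq, mink_smul_right] at hX
    exact (mul_eq_zero.1 hX).resolve_left hs
  have h2 := hf.lift_lift hz
  simp only [mink, lift_apply, nullLift_zero, nullLift_succ] at h1 h2
  have h3 := congrArg conj h1
  simp only [map_add, map_neg, map_mul, map_sum, Complex.conj_ofReal, map_zero] at h3
  push_cast
  simp only [← Complex.mul_conj', map_sub, map_mul, Complex.conj_ofReal, sub_mul, mul_sub,
    Finset.sum_sub_distrib]
  simp only [mink, vconj]
  have e1 : ∑ i, X 0 * (f z i : ℂ) * conj (X (Fin.succ i)) =
      X 0 * ∑ i, conj (X (Fin.succ i)) * (f z i : ℂ) := by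
    rw [Finset.mul_sum]; exact Finset.sum_congr rfl fun i _ => by ring
  have e2 : ∑ i, X (Fin.succ i) * (conj (X 0) * (f z i : ℂ)) =
      conj (X 0) * ∑ i, X (Fin.succ i) * (f z i : ℂ) := by
    rw [Finset.mul_sum]; exact Finset.sum_congr rfl fun i _ => by ring
  have e3 : ∑ i, X 0 * (f z i : ℂ) * (conj (X 0) * (f z i : ℂ)) =
      X 0 * conj (X 0) * ∑ i, (f z i : ℂ) * (f z i : ℂ) := by
    rw [Finset.mul_sum]; exact Finset.sum_congr rfl fun i _ => by ring
  rw [e1, e2, e3]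
  simp only [Complex.ofReal_one, mul_one] at h1 h2 h3
  linear_combination X 0 * h3 + conj (X 0) * h1 - X 0 * conj (X 0) * h2

end ConfOn

namespace IsoOn

section General

variable {n : ℕ} {f : ℂ → EuclideanSpace ℝ (Fin (n + 1))} {Ω : Set ℂ} {z : ℂ}

/-- If ⟨κ, κ̄⟩ vanished, κ would be a multiple of (1, f); as κ is orthogonal to N while Y is not, κ
would be 0, an umbilic point. -/
theorem kappaSq_pos (hf : IsoOn f Ω) (hz : z ∈ Ω) : 0 < (kappaSq f z).re := by
  have hc := hf.toConfOn
  have h := hc.mink_vconj_eq_sum hz (hc.kappa_orth hz).1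
  rw [kappaSq, h, Complex.ofReal_re]
  refine lt_of_le_of_ne (by positivity) fun h0 => hf.umb z hz ?_
  have h1 := (Finset.sum_eq_zero_iff_of_nonneg (fun i _ => by positivity)).1 h0.symm
  have h2 : kappa f z = kappa f z 0 • lift f z := by
    funext i
    refine Fin.cases ?_ (fun j => ?_) i
    · simp [lift_apply, nullLift_zero]
    · have := h1 j (Finset.mem_univ j)
      have := sub_eq_zero.1 (norm_eq_zero.1 (pow_eq_zero_iff two_ne_zero |>.1 this))
      simpa [lift_apply, nullLift_succ] using this
  have h3 := (hc.kappa_orth hz).2.2.2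
  have h4 := hc.N_Y hz
  rw [mink_comm, ConfOn.Y_eq, mink_smul_left] at h4
  rw [h2, mink_smul_left] at h3
  have h5 : kappa f z 0 = 0 := by
    rcases mul_eq_zero.1 h3 with h | h
    · exact h
    · rw [h] at h4; norm_num at h4
  rw [h2, h5, zero_smul]

theorem kappaSq_ne (hf : IsoOn f Ω) (hz : z ∈ Ω) : kappaSq f z ≠ 0 := fun h => by
  have := hf.kappaSq_pos hz
  rw [h] at this
  simp at this

theorem smoothOn_kappaSq (hf : IsoOn f Ω) : SmoothOn (kappaSq f) Ω :=
  hf.smoothOn_kappa.mink hf.smoothOn_kappa.vconj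

theorem hasW_kappa (hf : IsoOn f Ω) (hz : z ∈ Ω) :
    HasW (kappa f) (dz (kappa f) z) (dzbar (kappa f) z) z :=
  hf.smoothOn_kappa.hasW hf.isOpen hz

theorem DzbarKappa_vconj (hf : IsoOn f Ω) (hz : z ∈ Ω) :
    mink (DzbarKappa f z) (vconj (kappa f z)) = mink (dzbar (kappa f) z) (vconj (kappa f z)) := by
  obtain ⟨h1, h2, h3, h4⟩ := hf.vconj_kappa_orth hz
  exact ConfOn.mink_nproj h1 h2 h3 h4

theorem dzbar_kappa_vconj (hf : IsoOn f Ω) (hz : z ∈ Ω) :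
    mink (dzbar (kappa f) z) (vconj (kappa f z)) = -(conj (mu f z) / 2) * kappaSq f z := by
  have h := hf.kappaSq_ne hz
  rw [mu, Complex.conj_conj, hf.DzbarKappa_vconj hz]
  field_simp

theorem smoothOn_mu (hf : IsoOn f Ω) : SmoothOn (mu f) Ω := by
  have h : SmoothOn (fun z => conj (-2 * mink (dzbar (kappa f) z) (vconj (kappa f z))
      * (kappaSq f z)⁻¹)) Ω :=
    ((((hf.smoothOn_kappa.dzbar hf.isOpen).mink hf.smoothOn_kappa.vconj).const_smul (-2)).mul
      (hf.smoothOn_kappaSq.inv fun z hz => hf.kappaSq_ne hz)).conjugate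
  exact h.congr fun z hz => by rw [mu, hf.DzbarKappa_vconj hz, div_eq_mul_inv]

theorem dz_dzbar_mu (hf : IsoOn f Ω) (hz : z ∈ Ω) :
    dz (fun w => conj (mu f w)) z = conj (dzbar (mu f) z) :=
  (hf.smoothOn_mu.hasW hf.isOpen hz).conjugate.2.1

theorem hasW_kappaSq (hf : IsoOn f Ω) (hz : z ∈ Ω) :
    HasW (kappaSq f) (dz (kappaSq f) z) (dzbar (kappaSq f) z) z :=
  hf.smoothOn_kappaSq.hasW hf.isOpen hz

/-- Differentiating ⟨Y_zz, Y_z̄⟩ = 0 in z̄ and ⟨Y_z̄, Y_zz̄⟩ = 0 in z produces the same term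
⟨Y_zzz̄, Y_z̄⟩. Eliminating it leaves ⟨Y_zz̄, Y_zz̄⟩ = ⟨Y_zz, Y_z̄z̄⟩, and the Y-component of Y_zz
does not contribute to the right side. -/
theorem Yzzb_Yzzb (hf : IsoOn f Ω) (hz : z ∈ Ω) :
    mink (dzbar (dz (Y f)) z) (dzbar (dz (Y f)) z) = kappaSq f z := by
  have hc := hf.toConfOn
  have hzz := hc.smoothOn_Yzz.hasW hf.isOpen hz
  have hzzb := hc.smoothOn_Yzzb.hasW hf.isOpen hz
  have h1 := ((hzz.mink (hc.hasW_Yzb hz)).unique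
    ((hasW_const 0 z).congr hf.isOpen hz fun w hw => hc.Yzz_Yzb hw)).2
  have h2 := (((hc.hasW_Yzb hz).mink hzzb).unique
    ((hasW_const 0 z).congr hf.isOpen hz fun w hw => hc.Yzb_Yzzb hw)).1
  have h3 := hc.smoothOn_Yz.dz_dzbar_comm hf.isOpen hz
  rw [h3, mink_comm (dzbar (Y f) z)] at h2
  have h4 : kappaSq f z = mink (dz (dz (Y f)) z) (vconj (dz (dz (Y f)) z)) := by
    have a1 := hc.Y_Yzz hz
    have a2 : mink (dz (dz (Y f)) z) (Y f z) = 0 := by rw [mink_comm]; exact a1.1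
    have a3 : mink (Y f z) (vconj (dz (dz (Y f)) z)) = 0 := by
      rw [← ConfOn.vconj_Y, mink_vconj, a1.1, map_zero]
    rw [kappaSq, hc.kappa_eq hz, vconj_add, vconj_smul, ConfOn.vconj_Y]
    simp only [mink_add_left, mink_add_right, mink_smul_left, mink_smul_right, a2, a3, hc.Y_Y hz]
    ring
  rw [h4]
  linear_combination h2 - h1

theorem Yzz_eq (hf : IsoOn f Ω) (hz : z ∈ Ω) :
    dz (dz (Y f)) z = kappa f z - (schw f z / 2) • Y f z := by
  rw [hf.toConfOn.kappa_eq hz]; module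

theorem Yzzb_eq (hf : IsoOn f Ω) (hz : z ∈ Ω) :
    dzbar (dz (Y f)) z = (1 / 2 : ℂ) • N f z - kappaSq f z • Y f z := by
  rw [N, hf.Yzzb_Yzzb hz]; module

theorem mink_kappa_dkappa (hf : IsoOn f Ω) (hz : z ∈ Ω) :
    mink (dz (kappa f) z) (kappa f z) = 0 ∧ mink (dzbar (kappa f) z) (kappa f z) = 0 := by
  have h := ((hf.hasW_kappa hz).mink (hf.hasW_kappa hz)).unique
    ((hasW_const 0 z).congr hf.isOpen hz fun w hw => hf.iso w hw)
  simp only [mink_comm (kappa f z)] at h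
  exact ⟨by linear_combination h.1 / 2, by linear_combination h.2 / 2⟩

theorem mink_dkappa_Y (hf : IsoOn f Ω) (hz : z ∈ Ω) :
    mink (dz (kappa f) z) (Y f z) = 0 ∧ mink (dzbar (kappa f) z) (Y f z) = 0 := by
  have h := ((hf.hasW_kappa hz).mink (hf.hasW_Y hz)).unique
    ((hasW_const 0 z).congr hf.isOpen hz fun w hw => (hf.kappa_orth hw).1)
  rw [(hf.kappa_orth hz).2.1, (hf.kappa_orth hz).2.2.1] at h
  exact ⟨by linear_combination h.1, by linear_combination h.2⟩

theorem kappa_Yzzb (hf : IsoOn f Ω) (hz : z ∈ Ω) :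
    mink (kappa f z) (dzbar (dz (Y f)) z) = 0 := by
  rw [hf.Yzzb_eq hz, mink_sub_right, mink_smul_right, mink_smul_right, (hf.kappa_orth hz).1,
    (hf.kappa_orth hz).2.2.2]
  ring

theorem kappa_Yzz (hf : IsoOn f Ω) (hz : z ∈ Ω) :
    mink (kappa f z) (dz (dz (Y f)) z) = 0 := by
  rw [hf.Yzz_eq hz, mink_sub_right, mink_smul_right, (hf.kappa_orth hz).1, hf.iso z hz]
  ring

theorem kappa_vconj_Yzz (hf : IsoOn f Ω) (hz : z ∈ Ω) :
    mink (kappa f z) (vconj (dz (dz (Y f)) z)) = kappaSq f z := by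
  rw [hf.Yzz_eq hz, vconj_sub, vconj_smul, ConfOn.vconj_Y, mink_sub_right, mink_smul_right,
    (hf.kappa_orth hz).1, kappaSq]
  ring

theorem mink_dkappa_Yz (hf : IsoOn f Ω) (hz : z ∈ Ω) :
    mink (dz (kappa f) z) (dz (Y f) z) = 0 ∧ mink (dzbar (kappa f) z) (dz (Y f) z) = 0 := by
  have h := ((hf.hasW_kappa hz).mink (hf.hasW_Yz hz)).unique
    ((hasW_const 0 z).congr hf.isOpen hz fun w hw => (hf.kappa_orth hw).2.1)
  rw [hf.kappa_Yzz hz, hf.kappa_Yzzb hz] at h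
  exact ⟨by linear_combination h.1, by linear_combination h.2⟩

theorem mink_dkappa_Yzb (hf : IsoOn f Ω) (hz : z ∈ Ω) :
    mink (dz (kappa f) z) (dzbar (Y f) z) = 0 ∧
      mink (dzbar (kappa f) z) (dzbar (Y f) z) = -kappaSq f z := by
  have h := ((hf.hasW_kappa hz).mink (hf.hasW_Yzb hz)).unique
    ((hasW_const 0 z).congr hf.isOpen hz fun w hw => (hf.kappa_orth hw).2.2.1)
  rw [hf.kappa_vconj_Yzz hz, hf.kappa_Yzzb hz] at h
  exact ⟨by linear_combination h.1, by linear_combination h.2⟩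

theorem dz_kappa_vconj (hf : IsoOn f Ω) (hz : z ∈ Ω) :
    mink (dz (kappa f) z) (vconj (kappa f z)) =
      dz (kappaSq f) z + mu f z / 2 * kappaSq f z := by
  have h := ((hf.hasW_kappa hz).mink (hf.hasW_kappa hz).vconj).2.1
  have h' : dz (kappaSq f) z = _ := h
  have h2 : mink (kappa f z) (vconj (dzbar (kappa f) z)) = -(mu f z / 2) * kappaSq f z := by
    rw [← vconj_vconj (kappa f z), mink_vconj, mink_comm, hf.dzbar_kappa_vconj hz, map_mul,
      ConfOn.kappaSq_conj, map_neg, map_div₀, Complex.conj_conj, Complex.conj_ofNat]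
  rw [h', h2]
  ring

/-- The derivatives of `Y_zz̄`, expressed through those of `κ` and `s`. -/
theorem hasW_Yzzb (hf : IsoOn f Ω) (hz : z ∈ Ω) :
    HasW (dzbar (dz (Y f)))
      (dzbar (kappa f) z - (dzbar (schw f) z / 2) • Y f z - (schw f z / 2) • dzbar (Y f) z)
      (vconj (dzbar (kappa f) z - (dzbar (schw f) z / 2) • Y f z
        - (schw f z / 2) • dzbar (Y f) z)) z := by
  have hc := hf.toConfOn
  have h := hc.smoothOn_Yzzb.hasW hf.isOpen hz
  have h1 : dz (dzbar (dz (Y f))) z =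
      dzbar (kappa f) z - (dzbar (schw f) z / 2) • Y f z - (schw f z / 2) • dzbar (Y f) z := by
    -- Third derivatives commute, so Y_zz̄z is found by applying ∂_z̄ to Y_zz = κ - (s/2) Y.
    rw [hc.smoothOn_Yz.dz_dzbar_comm hf.isOpen hz]
    have h2 := HasW.congr (G := dz (dz (Y f))) ((hf.hasW_kappa hz).sub (((hc.smoothOn_schw.hasW hf.isOpen hz).const_smul
      (1 / 2)).smul (hf.hasW_Y hz))) hf.isOpen hz fun w hw => by
        rw [hf.Yzz_eq hw, smul_eq_mul, div_eq_inv_mul, one_div]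
    rw [h2.2.2]
    simp only [smul_eq_mul]
    module
  rw [← h1]
  exact ⟨h.1, rfl, dzbar_eq_vconj_dz hf.isOpen hc.smoothOn_Yzzb (fun w hw => hc.vconj_Yzzb hw) hz⟩

theorem hasW_N (hf : IsoOn f Ω) (hz : z ∈ Ω) :
    HasW (N f) ((2 : ℂ) • (dzbar (kappa f) z - (dzbar (schw f) z / 2) • Y f z
        - (schw f z / 2) • dzbar (Y f) z) + (2 * dz (kappaSq f) z) • Y f z
        + (2 * kappaSq f z) • dz (Y f) z)
      ((2 : ℂ) • (vconj (dzbar (kappa f) z - (dzbar (schw f) z / 2) • Y f z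
        - (schw f z / 2) • dzbar (Y f) z)) + (2 * dzbar (kappaSq f) z) • Y f z
        + (2 * kappaSq f z) • dzbar (Y f) z) z := by
  have h := HasW.congr (G := N f) (((hf.hasW_Yzzb hz).const_smul 2).add (((hf.hasW_kappaSq hz).const_mul 2).smul
    (hf.hasW_Y hz))) hf.isOpen hz fun w hw => by rw [N, hf.Yzzb_Yzzb hw]
  simpa only [add_assoc] using h

theorem mink_dkappa_N (hf : IsoOn f Ω) (hz : z ∈ Ω) :
    mink (dz (kappa f) z) (N f z) = 0 ∧
      mink (dzbar (kappa f) z) (N f z) = mu f z * kappaSq f z := by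
  have h := ((hf.hasW_kappa hz).mink (hf.hasW_N hz)).unique
    ((hasW_const 0 z).congr hf.isOpen hz fun w hw => (hf.kappa_orth hw).2.2.2)
  have h2 : mink (kappa f z) (vconj (dzbar (kappa f) z)) = -(mu f z / 2) * kappaSq f z := by
    rw [← vconj_vconj (kappa f z), mink_vconj, mink_comm, hf.dzbar_kappa_vconj hz, map_mul,
      ConfOn.kappaSq_conj, map_neg, map_div₀, Complex.conj_conj, Complex.conj_ofNat]
  have h3 : vconj (dzbar (Y f) z) = dz (Y f) z := by rw [hf.dzbar_Y hz, vconj_vconj]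
  have h4 : mink (kappa f z) (dzbar (kappa f) z) = 0 := by
    rw [mink_comm]; exact (hf.mink_kappa_dkappa hz).2
  simp only [vconj_sub, vconj_smul, ConfOn.vconj_Y, h3, mink_add_right, mink_sub_right,
    mink_smul_right, (hf.kappa_orth hz).1, (hf.kappa_orth hz).2.1, (hf.kappa_orth hz).2.2.1, h2,
    h4] at h
  exact ⟨by linear_combination h.1, by linear_combination h.2⟩

end General

/-! ### The moving frame of an isotropic surface in the four-sphere. -/

section Four

variable {f : ℂ → EuclideanSpace ℝ (Fin 5)} {Ω : Set ℂ} {z : ℂ}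

/-- Expansion of a vector in the frame `Y, Y_z, Y_z̄, N, κ, κ̄`. -/
theorem expand (hf : IsoOn f Ω) (hz : z ∈ Ω) (X : Fin 6 → ℂ) :
    X = (-mink X (N f z)) • Y f z + (2 * mink X (dzbar (Y f) z)) • dz (Y f) z
      + (2 * mink X (dz (Y f) z)) • dzbar (Y f) z + (-mink X (Y f z)) • N f z
      + (mink X (vconj (kappa f z)) / kappaSq f z) • kappa f z
      + (mink X (kappa f z) / kappaSq f z) • vconj (kappa f z) := by
  have hc := hf.toConfOn
  have hk := hf.kappaSq_ne hz
  have a1 := hc.Y_Y hz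
  have a2 := (hc.Y_Yz hz).1
  have a3 := (hc.Y_Yz hz).2
  have a4 := hc.Yz_Yz hz
  have a5 := hc.Yz_Yzb hz
  have a6 : mink (dzbar (Y f) z) (dzbar (Y f) z) = 0 := by
    rw [hc.dzbar_Y hz, mink_vconj, a4, map_zero]
  have a7 := hc.N_Y hz
  have a8 := hc.N_N hz
  have a9 := hc.N_Yz hz
  have a10 := hc.N_Yzb hz
  obtain ⟨k1, k2, k3, k4⟩ := hc.kappa_orth hz
  obtain ⟨l1, l2, l3, l4⟩ := hc.vconj_kappa_orth hz
  have k5 := hf.iso z hz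
  have l5 : mink (vconj (kappa f z)) (vconj (kappa f z)) = 0 := by rw [mink_vconj, k5, map_zero]
  have m : mink (kappa f z) (vconj (kappa f z)) = kappaSq f z := rfl
  have b2 := a2; have b3 := a3; have b5 := a5; have b7 := a7; have b9 := a9; have b10 := a10
  have c1 := k1; have c2 := k2; have c3 := k3; have c4 := k4
  have d1 := l1; have d2 := l2; have d3 := l3; have d4 := l4; have m' := m
  rw [mink_comm] at b2 b3 b5 b7 b9 b10 c1 c2 c3 c4 d1 d2 d3 d4 m'
  -- The dual functionals come from the only nonzero products ⟨Y, N⟩ = -1, ⟨Y_z, Y_z̄⟩ = 1/2 and ⟨κ,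
  -- κ̄⟩; isotropy makes κ and κ̄ null. The ambient dimension six is exactly the number of frame
  -- vectors.
  have h := eq_sum_of_biorthogonal
    ![Y f z, dz (Y f) z, dzbar (Y f) z, N f z, kappa f z, vconj (kappa f z)]
    ![minkBilin (-N f z), minkBilin ((2 : ℂ) • dzbar (Y f) z), minkBilin ((2 : ℂ) • dz (Y f) z),
      minkBilin (-Y f z), minkBilin ((kappaSq f z)⁻¹ • vconj (kappa f z)),
      minkBilin ((kappaSq f z)⁻¹ • kappa f z)] (by
    intro i j
    fin_cases i <;> fin_cases j <;>
      simp [a1, a2, a3, a4, a5, a6, a7, a8, a9, a10, k1, k2, k3,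
        k4, l1, l2, l3, l4, k5, l5, m, b2, b3, b5, b7, b9, b10, c1, c2, c3, c4, d1, d2, d3, d4,
        m', hk]) X
  refine h.trans ((Fin.sum_univ_six _).trans ?_)
  simp only [mink_comm X]
  simp [div_eq_inv_mul]

theorem dz_kappa (hf : IsoOn f Ω) (hz : z ∈ Ω) :
    dz (kappa f) z = (dz (kappaSq f) z / kappaSq f z + mu f z / 2) • kappa f z := by
  have hk := hf.kappaSq_ne hz
  rw [hf.expand hz (dz (kappa f) z), (hf.mink_dkappa_N hz).1, (hf.mink_dkappa_Yzb hz).1,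
    (hf.mink_dkappa_Yz hz).1, (hf.mink_dkappa_Y hz).1, (hf.mink_kappa_dkappa hz).1,
    hf.dz_kappa_vconj hz]
  have : (dz (kappaSq f) z + mu f z / 2 * kappaSq f z) / kappaSq f z =
      dz (kappaSq f) z / kappaSq f z + mu f z / 2 := by field_simp
  rw [this]
  simp

/-- Differentiating ⟨κ, κ⟩ = 0 shows that there is no κ̄-component, so the normal part is a multiple
of κ, as the definition of μ presupposes. The tangential components come from differentiating the
orthogonality of κ to V. -/
theorem dzbar_kappa (hf : IsoOn f Ω) (hz : z ∈ Ω) :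
    dzbar (kappa f) z = (-(mu f z * kappaSq f z)) • Y f z - (2 * kappaSq f z) • dz (Y f) z
      - (conj (mu f z) / 2) • kappa f z := by
  have hk := hf.kappaSq_ne hz
  rw [hf.expand hz (dzbar (kappa f) z), (hf.mink_dkappa_N hz).2, (hf.mink_dkappa_Yzb hz).2,
    (hf.mink_dkappa_Yz hz).2, (hf.mink_dkappa_Y hz).2, (hf.mink_kappa_dkappa hz).2,
    hf.dzbar_kappa_vconj hz, mul_div_cancel_right₀ _ hk]
  simp only [neg_zero, mul_zero, zero_div]
  module

end Four

end IsoOn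

/-! ### Compatibility equations and the Möbius curvature -/

theorem HasW.comp_hasDerivAt {F : ℂ → ℂ} {a b z : ℂ} (hF : HasW F a b z) {g : ℂ → ℂ} {g' : ℂ}
    (hg : HasDerivAt g g' (F z)) : HasW (fun w => g (F w)) (g' * a) (g' * b) z := by
  have h1 : HasFDerivAt (fun w => g (F w)) _ z :=
    (hg.hasFDerivAt.restrictScalars ℝ).comp z hF.1.hasFDerivAt
  refine ⟨h1.differentiableAt, ?_, ?_⟩
  · rw [← hF.2.1]; simp [dz, h1.fderiv]; ring
  · rw [← hF.2.2]; simp [dzbar, h1.fderiv]; ring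

namespace IsoOn

variable {f : ℂ → EuclideanSpace ℝ (Fin 5)} {Ω : Set ℂ} {z : ℂ}

theorem hasW_mu (hf : IsoOn f Ω) (hz : z ∈ Ω) : HasW (mu f) (dz (mu f) z) (dzbar (mu f) z) z :=
  hf.smoothOn_mu.hasW hf.isOpen hz

/-- The logarithmic derivative of `⟨κ, κ̄⟩`. -/
def logDer (f : ℂ → EuclideanSpace ℝ (Fin 5)) (z : ℂ) : ℂ := (kappaSq f z)⁻¹ * dz (kappaSq f) z

theorem smoothOn_logDer (hf : IsoOn f Ω) : SmoothOn (logDer f) Ω :=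
  (hf.smoothOn_kappaSq.inv fun _ hz => hf.kappaSq_ne hz).mul (hf.smoothOn_kappaSq.dz hf.isOpen)

theorem dz_kappaSq (hf : IsoOn f Ω) (hz : z ∈ Ω) :
    dz (kappaSq f) z = logDer f z * kappaSq f z := by
  have := hf.kappaSq_ne hz
  rw [logDer]; field_simp

theorem dz_kappa_eq (hf : IsoOn f Ω) (hz : z ∈ Ω) :
    dz (kappa f) z = (logDer f z + mu f z / 2) • kappa f z := by
  rw [hf.dz_kappa hz, logDer, div_eq_inv_mul]

theorem hasW_logDer (hf : IsoOn f Ω) (hz : z ∈ Ω) :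
    HasW (logDer f) (dz (logDer f) z) (dzbar (logDer f) z) z :=
  hf.smoothOn_logDer.hasW hf.isOpen hz

/-- Equality of the mixed derivatives of `κ`. -/
theorem kappa_compat (hf : IsoOn f Ω) (hz : z ∈ Ω) :
    (dzbar (logDer f) z + dzbar (mu f) z / 2) • kappa f z +
        (logDer f z + mu f z / 2) • dzbar (kappa f) z =
      (-(dz (mu f) z * kappaSq f z + mu f z * dz (kappaSq f) z)) • Y f z
        + (-(mu f z * kappaSq f z)) • dz (Y f) z - (2 * dz (kappaSq f) z) • dz (Y f) z
        - (2 * kappaSq f z) • dz (dz (Y f)) z - (conj (dzbar (mu f) z) / 2) • kappa f z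
        - (conj (mu f z) / 2) • dz (kappa f) z := by
  have h1 := HasW.congr (G := dz (kappa f)) (((hf.hasW_logDer hz).add
    ((hf.hasW_mu hz).const_mul (1 / 2))).smul (hf.hasW_kappa hz)) hf.isOpen hz fun w hw => by
      rw [hf.dz_kappa_eq hw, div_eq_inv_mul, one_div]
  have h2 := HasW.congr (G := dzbar (kappa f)) ((((((hf.hasW_mu hz).mul
    (hf.hasW_kappaSq hz)).neg.smul (hf.hasW_Y hz))).sub
      (((hf.hasW_kappaSq hz).const_mul 2).smul (hf.hasW_Yz hz))).sub
      (((hf.hasW_mu hz).conjugate.const_mul (1 / 2)).smul (hf.hasW_kappa hz))) hf.isOpen hz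
        fun w hw => by rw [hf.dzbar_kappa hw, div_eq_inv_mul, one_div]
  have h3 := hf.smoothOn_kappa.dz_dzbar_comm hf.isOpen hz
  rw [h1.2.2, h2.2.1] at h3
  refine Eq.trans ?_ (h3.symm.trans ?_) <;> module

/-- The Ricci equation. -/
theorem dzbar_logDer (hf : IsoOn f Ω) (hz : z ∈ Ω) :
    dzbar (logDer f) z =
      -2 * kappaSq f z - (dzbar (mu f) z + conj (dzbar (mu f) z)) / 2 := by
  have hk := hf.kappaSq_ne hz
  -- Pairing with κ̄ extracts the κ-component of the mixed derivative identity.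
  have h := congrArg (fun X => mink X (vconj (kappa f z))) (hf.kappa_compat hz)
  obtain ⟨l1, l2, l3, l4⟩ := hf.vconj_kappa_orth hz
  rw [mink_comm] at l1 l2 l3 l4
  have m : mink (kappa f z) (vconj (kappa f z)) = kappaSq f z := rfl
  have n : mink (dz (dz (Y f)) z) (vconj (kappa f z)) = kappaSq f z := by
    rw [hf.Yzz_eq hz, mink_sub_left, mink_smul_left, l1, m]; ring
  simp only [hf.dz_kappa_eq hz, mink_add_left, mink_sub_left, mink_smul_left,
    hf.dzbar_kappa_vconj hz, l1, l2, m, n] at h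
  apply mul_right_cancel₀ hk
  linear_combination h

/-- The Codazzi equation. -/
theorem schw_eq (hf : IsoOn f Ω) (hz : z ∈ Ω) : schw f z = dz (mu f) z - mu f z ^ 2 / 2 := by
  have hk := hf.kappaSq_ne hz
  -- Pairing with N extracts the Y-component, where s enters through Y_zz.
  have h := congrArg (fun X => mink X (N f z)) (hf.kappa_compat hz)
  obtain ⟨k1, k2, k3, k4⟩ := hf.kappa_orth hz
  have a7 := hf.N_Y hz
  have a9 := hf.N_Yz hz
  rw [mink_comm] at a7 a9
  have n : mink (dz (dz (Y f)) z) (N f z) = schw f z / 2 := by rw [schw]; ring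
  simp only [hf.dz_kappa_eq hz, mink_add_left, mink_sub_left, mink_smul_left,
    (hf.mink_dkappa_N hz).2, k4, a7, a9, n, hf.dz_kappaSq hz] at h
  apply mul_right_cancel₀ hk
  linear_combination h

/-- The Gauss equation. -/
theorem dzbar_schw (hf : IsoOn f Ω) (hz : z ∈ Ω) :
    dzbar (schw f) z = 2 * dz (kappaSq f) z - 2 * mu f z * kappaSq f z := by
  have hN := hf.smoothOn_N.hasW hf.isOpen hz
  have h1 := (hN.mink hN).unique
    ((hasW_const 0 z).congr hf.isOpen hz fun w hw => hf.N_N hw)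
  rw [mink_comm (N f z)] at h1
  -- Y_zz̄ = N/2 - kY gives a second expression for Y_zz̄z. Pairing both with N removes the unknown
  -- N_z, because ⟨N, N⟩ = 0 gives ⟨N_z, N⟩ = 0.
  have h2 := HasW.congr (G := dzbar (dz (Y f))) ((hN.const_smul (1 / 2)).sub
    ((hf.hasW_kappaSq hz).smul (hf.hasW_Y hz))) hf.isOpen hz fun w hw => hf.Yzzb_eq hw
  have h3 := congrArg (fun X => mink X (N f z)) ((hf.hasW_Yzzb hz).unique h2).1
  have a7 := hf.N_Y hz
  have a9 := hf.N_Yz hz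
  have a10 := hf.N_Yzb hz
  rw [mink_comm] at a7 a9 a10
  simp only [mink_add_left, mink_sub_left, mink_smul_left, (hf.mink_dkappa_N hz).2, a7, a9,
    a10] at h3
  linear_combination 2 * h3 + h1.1 / 2

/-- The conjugate of `𝒫`. -/
def conjP (f : ℂ → EuclideanSpace ℝ (Fin 5)) (z : ℂ) : ℂ :=
  (dzbar (mu f) z - 2 * kappaSq f z) * (kappaSq f z)⁻¹

theorem invP_eq (hf : IsoOn f Ω) (hz : z ∈ Ω) : invP f z = conj (conjP f z) := by
  rw [invP, rho, hf.dz_dzbar_mu hz, conjP, map_mul, map_inv₀, map_sub, map_mul,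
    ConfOn.kappaSq_conj, Complex.conj_ofNat, div_eq_mul_inv]

theorem smoothOn_conjP (hf : IsoOn f Ω) : SmoothOn (conjP f) Ω :=
  ((hf.smoothOn_mu.dzbar hf.isOpen).sub (hf.smoothOn_kappaSq.const_smul 2)).mul
    (hf.smoothOn_kappaSq.inv fun _ hz => hf.kappaSq_ne hz)

/-- Taking ∂_z̄ of the Codazzi equation and inserting the Gauss equation gives (μ_z̄ - 2k)_z = μ
(μ_z̄ - 2k); dividing by k adds the term with the logarithmic derivative. -/
theorem dz_conjP (hf : IsoOn f Ω) (hz : z ∈ Ω) :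
    dz (conjP f) z = conjP f z * (mu f z - logDer f z) := by
  have hk := hf.kappaSq_ne hz
  have hμz := (hf.smoothOn_mu.dz hf.isOpen).hasW hf.isOpen hz
  have hμzb := (hf.smoothOn_mu.dzbar hf.isOpen).hasW hf.isOpen hz
  have h1 := HasW.congr (G := schw f) (hμz.sub (((hf.hasW_mu hz).mul (hf.hasW_mu hz)).const_mul
    (1 / 2))) hf.isOpen hz fun w hw => by rw [hf.schw_eq hw]; ring
  have h2 := h1.2.2
  rw [hf.dzbar_schw hz, ← hf.smoothOn_mu.dz_dzbar_comm hf.isOpen hz] at h2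
  have h3 := ((hμzb.sub ((hf.hasW_kappaSq hz).const_mul 2)).mul ((hf.hasW_kappaSq hz).inv hk)).2.1
  have h4 : dz (conjP f) z = _ := h3
  rw [h4, conjP]
  rw [hf.dz_kappaSq hz] at h2 ⊢
  field_simp
  linear_combination -h2

/-- Put Q = conj 𝒫 and a = μ - (log k)_z. Then Q_z = Qa and, since conj Q = -Q, also Q_z̄ = Q conj
a. The mixed derivatives agree only if Q (a_z̄ - conj a_z̄) = 0. As (log k)_{zz̄} is real and μ_z̄ =
kQ + 2k, the bracket is 2kQ, so kQ² = 0. -/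
theorem conjP_eq_zero (hf : IsoOn f Ω) (h : ∀ w ∈ Ω, (conjP f w).re = 0) (hz : z ∈ Ω) :
    conjP f z = 0 := by
  have hk := hf.kappaSq_ne hz
  have hc : ∀ w ∈ Ω, conj (conjP f w) = -conjP f w := fun w hw => by
    apply Complex.ext <;> simp [h w hw]
  have hQ : ∀ w ∈ Ω, HasW (conjP f) (dz (conjP f) w) (dzbar (conjP f) w) w :=
    fun w hw => hf.smoothOn_conjP.hasW hf.isOpen hw
  have h1 : ∀ w ∈ Ω, dzbar (conjP f) w = conjP f w * conj (mu f w - logDer f w) := by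
    intro w hw
    have e := ((hQ w hw).neg.unique ((hQ w hw).conjugate.congr hf.isOpen hw
      fun v hv => (hc v hv).symm)).2
    rw [hf.dz_conjP hw, map_mul, hc w hw] at e
    linear_combination -e
  have ha := (hf.hasW_mu hz).sub (hf.hasW_logDer hz)
  have h2 := (HasW.congr (G := dz (conjP f)) ((hQ z hz).mul ha) hf.isOpen hz
    fun w hw => hf.dz_conjP hw).2.2
  have h3 := (HasW.congr (G := dzbar (conjP f)) ((hQ z hz).mul ha.conjugate) hf.isOpen hz
    fun w hw => h1 w hw).2.1
  rw [← hf.smoothOn_conjP.dz_dzbar_comm hf.isOpen hz, h3, h1 z hz, hf.dz_conjP hz,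
    hf.dzbar_logDer hz] at h2
  have h4 : dzbar (mu f) z = conjP f z * kappaSq f z + 2 * kappaSq f z := by
    rw [conjP]; field_simp; ring
  simp only [map_sub, map_mul, map_neg, map_add, map_div₀, Complex.conj_conj,
    ConfOn.kappaSq_conj, Complex.conj_ofNat] at h2
  rw [h4] at h2
  simp only [map_add, map_mul, ConfOn.kappaSq_conj, Complex.conj_ofNat, hc z hz] at h2
  have h5 : conjP f z * (conjP f z * kappaSq f z) = 0 := by linear_combination -h2 / 2
  simpa [hk] using h5

theorem kappaSq_eq_ofReal (f : ℂ → EuclideanSpace ℝ (Fin 5)) (z : ℂ) :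
    kappaSq f z = ((kappaSq f z).re : ℂ) :=
  (Complex.conj_eq_iff_re.1 (ConfOn.kappaSq_conj f z)).symm

/-- Here 2ω = log 4k, so ω_{zz̄} is half the left side of the Ricci equation, and only Re μ_z̄
survives on the right. -/
theorem curvK_eq (hf : IsoOn f Ω) (hz : z ∈ Ω) : curvK f z = 2 + (conjP f z).re / 2 := by
  have hω : ∀ w ∈ Ω, (omega f w : ℂ) = (1 / 2) * Complex.log (4 * kappaSq f w) := by
    intro w hw
    have hp := hf.kappaSq_pos hw
    rw [kappaSq_eq_ofReal f w, omega]
    have : (4 : ℂ) * ((kappaSq f w).re : ℂ) = ((4 * (kappaSq f w).re : ℝ) : ℂ) := by push_cast; rfl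
    rw [this, ← Complex.ofReal_log (by positivity)]
    push_cast; ring
  have h1 : ∀ w ∈ Ω, dz (fun w => (omega f w : ℂ)) w = (1 / 2) * logDer f w := by
    intro w hw
    have hp := hf.kappaSq_pos hw
    -- Positivity of k keeps 4k off the branch cut, so the holomorphic chain rule applies to the
    -- logarithm.
    have hs : 4 * kappaSq f w ∈ Complex.slitPlane := by
      left; simp; exact hp
    have e := (HasW.congr (G := fun w => (omega f w : ℂ)) ((((hf.hasW_kappaSq hw).const_mul
      4).comp_hasDerivAt (Complex.hasDerivAt_log hs)).const_mul (1 / 2)) hf.isOpen hw hω).2.1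
    rw [e, logDer]
    field_simp
  have h2 := (HasW.congr (G := dz fun w => (omega f w : ℂ)) ((hf.hasW_logDer hz).const_mul
    (1 / 2)) hf.isOpen hz h1).2.2
  have hp := hf.kappaSq_pos hz
  have hexp : Real.exp (-2 * omega f z) = (4 * (kappaSq f z).re)⁻¹ := by
    rw [omega, ← Real.exp_log (show 0 < (4 * (kappaSq f z).re)⁻¹ by positivity), Real.log_inv]
    congr 1; ring
  rw [curvK, h2, hf.dzbar_logDer hz, hexp, conjP, kappaSq_eq_ofReal f z, ← Complex.ofReal_inv,
    Complex.re_mul_ofReal]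
  have e2 : ((1 / 2 : ℂ) * (-2 * ((kappaSq f z).re : ℂ) -
      (dzbar (mu f) z + conj (dzbar (mu f) z)) / 2)).re =
      -(kappaSq f z).re - (dzbar (mu f) z).re / 2 := by
    rw [Complex.add_conj]
    have : (1 / 2 : ℂ) * (-2 * ((kappaSq f z).re : ℂ) - ((2 * (dzbar (mu f) z).re : ℝ) : ℂ) / 2) =
      ((-(kappaSq f z).re - (dzbar (mu f) z).re / 2 : ℝ) : ℂ) := by push_cast; ring
    rw [this, Complex.ofReal_re]
  rw [e2]
  simp
  field_simp
  ring

theorem invP_zero_iff_curvK (hf : IsoOn f Ω) :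
    (∀ z ∈ Ω, invP f z = 0) ↔ ∀ z ∈ Ω, curvK f z = 2 := by
  constructor
  · intro h z hz
    have h1 := h z hz
    rw [hf.invP_eq hz, map_eq_zero] at h1
    rw [hf.curvK_eq hz, h1]
    simp
  · intro h z hz
    rw [hf.invP_eq hz, map_eq_zero]
    refine hf.conjP_eq_zero (fun w hw => ?_) hz
    have := h w hw
    rw [hf.curvK_eq hw] at this
    linarith

theorem invP_eq_zero_iff (hf : IsoOn f Ω) (hz : z ∈ Ω) :
    invP f z = 0 ↔ dzbar (mu f) z = 2 * kappaSq f z := by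
  rw [hf.invP_eq hz, map_eq_zero, conjP, mul_eq_zero, inv_eq_zero, sub_eq_zero]
  exact or_iff_left (hf.kappaSq_ne hz)

end IsoOn

/-! ### Complexification of real linear maps -/

section Complexify

/-- Real vectors as complex vectors. -/
def rc {n : ℕ} (X : Fin n → ℝ) : Fin n → ℂ := fun i => (X i : ℂ)

/-- The complexification of a real linear map. -/
def cx {m n : ℕ} (A : (Fin m → ℝ) →ₗ[ℝ] (Fin n → ℝ)) : (Fin m → ℂ) →ₗ[ℂ] (Fin n → ℂ) :=
  Matrix.toLin' ((LinearMap.toMatrix' A).map Complex.ofReal)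

theorem cx_rc {m n : ℕ} (A : (Fin m → ℝ) →ₗ[ℝ] (Fin n → ℝ)) (X : Fin m → ℝ) :
    cx A (rc X) = rc (A X) := by
  funext i
  have h : A X i = ∑ j, LinearMap.toMatrix' A i j * X j := by
    conv_lhs => rw [← Matrix.toLin'_toMatrix' A]
    simp only [Matrix.toLin'_apply, Matrix.mulVec, dotProduct]
  simp only [cx, rc, Matrix.toLin'_apply, Matrix.mulVec, dotProduct, Matrix.map_apply, h]
  push_cast
  rfl

theorem eq_rc_add {m : ℕ} (X : Fin m → ℂ) :
    X = rc (fun i => (X i).re) + Complex.I • rc (fun i => (X i).im) := by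
  funext i
  simp only [rc, Pi.add_apply, Pi.smul_apply, smul_eq_mul]
  rw [mul_comm, Complex.re_add_im]

theorem vconj_rc {m : ℕ} (X : Fin m → ℝ) : vconj (rc X) = rc X := by
  funext i; simp [vconj, rc]

theorem mink_rc {m : ℕ} (X X' : Fin (m + 1) → ℝ) : mink (rc X) (rc X') = ((mink X X' : ℝ) : ℂ) := by
  simp [mink, rc]

theorem vconj_cx {m n : ℕ} (A : (Fin m → ℝ) →ₗ[ℝ] (Fin n → ℝ)) (X : Fin m → ℂ) :
    vconj (cx A X) = cx A (vconj X) := by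
  rw [eq_rc_add X]
  simp only [map_add, map_smul, vconj_add, vconj_smul, vconj_rc, cx_rc]

theorem mink_cx {m n : ℕ} {A : (Fin (m + 1) → ℝ) →ₗ[ℝ] (Fin (n + 1) → ℝ)}
    (hA : ∀ X X', mink (A X) (A X') = mink X X') (X X' : Fin (m + 1) → ℂ) :
    mink (cx A X) (cx A X') = mink X X' := by
  rw [eq_rc_add X, eq_rc_add X']
  simp only [map_add, map_smul, cx_rc, mink_add_left, mink_add_right, mink_smul_left,
    mink_smul_right, mink_rc, hA]

theorem HasW.linearMap {m n : ℕ} {F : ℂ → Fin m → ℂ} {a b : Fin m → ℂ} {z : ℂ}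
    (h : HasW F a b z) (L : (Fin m → ℂ) →ₗ[ℂ] (Fin n → ℂ)) :
    HasW (fun w => L (F w)) (L a) (L b) z :=
  h.clm L.toContinuousLinearMap

end Complexify

/-! ### Complex curves satisfy 𝒫 = 0. -/

namespace IsoOn

variable {f : ℂ → EuclideanSpace ℝ (Fin 5)} {Ω : Set ℂ} {z : ℂ}

/-- If the mean curvature spheres all contain a fixed point, and the surface avoids this point,
then `𝒫 = 0`. -/
theorem dzbar_mu_of_null (hf : IsoOn f Ω) {E : Fin 6 → ℂ} (hreal : vconj E = E)
    (hnull : mink E E = 0) (hκ : ∀ w ∈ Ω, mink (kappa f w) E = 0)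
    (hY : ∀ w ∈ Ω, mink (Y f w) E ≠ 0) (hz : z ∈ Ω) : dzbar (mu f) z = 2 * kappaSq f z := by
  -- Differentiate ⟨κ, E⟩ = 0 in z̄: the κ-term drops out and a common factor 2k cancels.
  have h1 : ∀ w ∈ Ω, mink (dz (Y f) w) E = -(mu f w / 2) * mink (Y f w) E := by
    intro w hw
    have e := (((hf.hasW_kappa hw).mink (hasW_const E w)).unique
      ((hasW_const 0 w).congr hf.isOpen hw hκ)).2
    rw [hf.dzbar_kappa hw, mink_zero_right] at e
    simp only [mink_sub_left, mink_smul_left, hκ w hw] at e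
    have hk := hf.kappaSq_ne hw
    apply mul_left_cancel₀ (mul_ne_zero two_ne_zero hk)
    linear_combination -e
  have h2 : mink (dzbar (Y f) z) E = -(conj (mu f z) / 2) * mink (Y f z) E := by
    have hα : conj (mink (Y f z) E) = mink (Y f z) E := by
      rw [← mink_vconj, ConfOn.vconj_Y, hreal]
    rw [hf.dzbar_Y hz, ← hreal, mink_vconj, h1 z hz, map_mul, hα, hreal,
      map_neg, map_div₀, Complex.conj_ofNat]
  -- A second z̄-derivative brings in μ_z̄ and, through Y_zz̄, the unknown ⟨N, E⟩. The latter is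
  -- eliminated in `h4` by expanding ⟨E, E⟩ = 0 in the frame.
  have h3 := (((hf.hasW_Yz hz).mink (hasW_const E z)).unique
    (HasW.congr (((hf.hasW_mu hz).const_mul (-(1 / 2))).mul ((hf.hasW_Y hz).mink
      (hasW_const E z))) hf.isOpen hz fun w hw => by rw [h1 w hw]; ring)).2
  rw [hf.Yzzb_eq hz] at h3
  simp only [mink_sub_left, mink_smul_left, h2, mink_zero_right] at h3
  have h4 := congrArg (fun X => mink X E) (hf.expand hz E)
  simp only [mink_add_left, mink_smul_left, hκ z hz, mink_comm E, hnull, h1 z hz, h2] at h4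
  have hα := hY z hz
  apply mul_right_cancel₀ (pow_ne_zero 2 hα)
  linear_combination 2 * (mink (Y f z) E) * h3 - h4 / 2

/-- The vector `(1, 1, 0, 0, 0, 0)` representing the pole of the stereographic projection. -/
def poleVec {m : ℕ} : Fin (m + 2) → ℝ := Fin.cons 1 (Fin.cons 1 fun _ => 0)

theorem mink_rc_poleVec {m : ℕ} (X : Fin (m + 2) → ℂ) : mink X (rc poleVec) = -X 0 + X 1 := by
  simp [mink, rc, poleVec, Fin.sum_univ_succ]

/-- The polynomial lift `(‖x‖² + 1, ‖x‖² - 1, 2x)` of the inverse stereographic projection. -/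
def stereoLift {m : ℕ} (x : EuclideanSpace ℝ (Fin m)) : Fin (m + 2) → ℝ :=
  Fin.cons (‖x‖ ^ 2 + 1) (Fin.cons (‖x‖ ^ 2 - 1) fun i => 2 * x i)

theorem nullLift_invStereo {m : ℕ} (x : EuclideanSpace ℝ (Fin m)) :
    nullLift (invStereo x).1 = (‖x‖ ^ 2 + 1)⁻¹ • stereoLift x := by
  have hpos : ‖x‖ ^ 2 + 1 ≠ 0 := by positivity
  funext i
  refine Fin.cases ?_ (fun j => Fin.cases ?_ (fun k => ?_) j) i
  · simp [nullLift, stereoLift, hpos]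
  · simp [nullLift, stereoLift, invStereo, invStereoVec]; field_simp
  · simp [nullLift, stereoLift, invStereo, invStereoVec]; field_simp

theorem smoothOn_stereoLift {m : ℕ} {h : ℂ → EuclideanSpace ℝ (Fin m)}
    (hh : ContDiffOn ℝ ∞ h Ω) : SmoothOn (fun w => rc (stereoLift (h w))) Ω := by
  refine SmoothOn.of_pi fun i => SmoothOn.ofReal ?_
  refine Fin.cases ?_ (fun j => Fin.cases ?_ (fun k => ?_) j) i
  · exact (hh.norm_sq ℝ).add contDiffOn_const
  · exact (hh.norm_sq ℝ).sub contDiffOn_const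
  · exact contDiffOn_const.mul ((EuclideanSpace.proj k : _ →L[ℝ] ℝ).contDiff.comp_contDiffOn hh)

/-- A holomorphic curve in `(ℝ^m, J)` is harmonic. -/
theorem dzbar_dz_holomorphic {m : ℕ} (hΩ : IsOpen Ω) {h : ℂ → EuclideanSpace ℝ (Fin m)}
    (hh : ContDiffOn ℝ ∞ h Ω) {J : EuclideanSpace ℝ (Fin m) →ₗ[ℝ] EuclideanSpace ℝ (Fin m)}
    (hJ : ∀ v, J (J v) = -v) (hol : ∀ w ∈ Ω, fderiv ℝ h w Complex.I = J (fderiv ℝ h w 1))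
    (hz : z ∈ Ω) : dzbar (dz fun w => rc (h w).ofLp) z = 0 := by
  set hc : ℂ → Fin m → ℂ := fun w => rc (h w).ofLp with hc_def
  have hs : SmoothOn hc Ω := SmoothOn.of_pi fun i =>
    SmoothOn.ofReal ((EuclideanSpace.proj i : _ →L[ℝ] ℝ).contDiff.comp_contDiffOn hh)
  have hd : ∀ w ∈ Ω, dz hc w = (1 / 2 : ℂ) • (rc (fderiv ℝ h w 1).ofLp
      - Complex.I • rc (fderiv ℝ h w Complex.I).ofLp) := by
    intro w hw
    have hdw : DifferentiableAt ℝ h w :=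
      (hh.contDiffAt (hΩ.mem_nhds hw)).differentiableAt (by simp)
    funext i
    rw [← ((hs.hasW hΩ hw).apply i).2.1]
    exact (hasW_ofReal_apply hdw i).2.1
  set A : (Fin m → ℝ) →ₗ[ℝ] (Fin m → ℝ) :=
    (WithLp.linearEquiv 2 ℝ (Fin m → ℝ)).toLinearMap ∘ₗ J ∘ₗ
      (WithLp.linearEquiv 2 ℝ (Fin m → ℝ)).symm.toLinearMap with hA
  have hAJ : ∀ v : EuclideanSpace ℝ (Fin m), A v.ofLp = (J v).ofLp := fun v => rfl
  -- Holomorphy says J h_z = i h_z. As J is constant, h_zz̄ lies in the same eigenspace; being real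
  -- it also lies in the conjugate one, so it vanishes.
  have h1 : ∀ w ∈ Ω, cx A (dz hc w) = Complex.I • dz hc w := by
    intro w hw
    rw [hd w hw, map_smul, map_sub, map_smul, cx_rc, cx_rc, hAJ, hAJ, hol w hw, hJ]
    have e : rc (-(fderiv ℝ h w 1)).ofLp = -rc (fderiv ℝ h w 1).ofLp := by
      funext i; simp [rc]
    rw [e, smul_comm Complex.I, smul_sub Complex.I, smul_smul Complex.I Complex.I,
      Complex.I_mul_I]
    module
  have hW := (hs.dz hΩ).hasW hΩ hz
  have h2 := ((hW.linearMap (cx A)).unique ((hW.const_smul Complex.I).congr hΩ hz h1)).2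
  have hr : ∀ w ∈ Ω, vconj (hc w) = hc w := fun w _ => vconj_rc _
  have h3 : vconj (dzbar (dz hc) z) = dzbar (dz hc) z := by
    rw [← (dzbar_vconj hΩ (hs.dz hΩ) (fun w hw => dzbar_eq_vconj_dz hΩ hs hr hw) hz).2,
      hs.dz_dzbar_comm hΩ hz]
  have h4 := congrArg vconj h2
  rw [vconj_cx, vconj_smul, h3, h2, Complex.conj_I] at h4
  have h5 : (2 * Complex.I) • dzbar (dz hc) z = 0 := by
    rw [two_mul, add_smul]; nth_rewrite 1 [h4]; module
  exact (smul_eq_zero.1 h5).resolve_left (by simp)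

/-- A surface which is Möbius equivalent to a complex curve satisfies `𝒫 = 0`. -/
theorem dzbar_mu_of_complexCurve (hf : IsoOn f Ω) {h : ℂ → EuclideanSpace ℝ (Fin 4)}
    (hh : ContDiffOn ℝ ∞ h Ω) {J : EuclideanSpace ℝ (Fin 4) →ₗ[ℝ] EuclideanSpace ℝ (Fin 4)}
    (hJ : ∀ v, J (J v) = -v) (hol : ∀ w ∈ Ω, fderiv ℝ h w Complex.I = J (fderiv ℝ h w 1))
    {A : (Fin 6 → ℝ) →ₗ[ℝ] (Fin 6 → ℝ)} (hA : ∀ X X', mink (A X) (A X') = mink X X')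
    (hAf : ∀ w ∈ Ω, ∃ c : ℝ, c ≠ 0 ∧ A (nullLift (f w)) = c • nullLift (invStereo (h w)).1)
    (hz : z ∈ Ω) : dzbar (mu f) z = 2 * kappaSq f z := by
  have hΩ := hf.isOpen
  set H : ℂ → Fin 6 → ℂ := fun w => rc (stereoLift (h w)) with H_def
  have hH : SmoothOn H Ω := smoothOn_stereoLift hh
  -- The Möbius map supplies its scalar only pointwise. Since H pairs to -2 with the pole vector,
  -- this formula recovers the factor in A Y = b H as a visibly smooth function.
  set b : ℂ → ℂ := fun w => -(1 / 2) * mink (cx A (Y f w)) (rc poleVec) with b_def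
  have hHe : ∀ w, mink (H w) (rc poleVec) = -2 := by
    intro w
    rw [mink_rc_poleVec]
    simp [H_def, rc, stereoLift]
    ring
  have hZ : ∀ w ∈ Ω, cx A (Y f w) = b w • H w ∧ b w ≠ 0 := by
    intro w hw
    obtain ⟨c, hc, e⟩ := hAf w hw
    have hpos : ‖h w‖ ^ 2 + 1 ≠ 0 := by positivity
    have e1 : cx A (Y f w) = ((scale f w * c * (‖h w‖ ^ 2 + 1)⁻¹ : ℝ) : ℂ) • H w := by
      have : lift f w = rc (nullLift (f w)) := rfl
      rw [ConfOn.Y_eq, map_smul, this, cx_rc, e, nullLift_invStereo]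
      funext i
      simp [rc, H_def]
      ring
    have e2 : b w = ((scale f w * c * (‖h w‖ ^ 2 + 1)⁻¹ : ℝ) : ℂ) := by
      simp only [b_def]
      rw [e1, mink_smul_left, hHe]
      ring
    refine ⟨by rw [e2]; exact e1, ?_⟩
    rw [e2]
    exact Complex.ofReal_ne_zero.2
      (mul_ne_zero (mul_ne_zero (hf.scale_pos hw).ne' hc) (inv_ne_zero hpos))
  have hbs : SmoothOn b Ω :=
    ((hf.smoothOn_Y.clm (cx A).toContinuousLinearMap).mink (SmoothOn.const _)).const_smul _
  have hbW : ∀ w ∈ Ω, HasW b (dz b w) (dzbar b w) w := fun w hw => hbs.hasW hΩ hw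
  have hHW : ∀ w ∈ Ω, HasW H (dz H w) (dzbar H w) w := fun w hw => hH.hasW hΩ hw
  have hYz : ∀ w ∈ Ω, cx A (dz (Y f) w) = dz b w • H w + b w • dz H w ∧
      cx A (dzbar (Y f) w) = dzbar b w • H w + b w • dzbar H w := fun w hw =>
    ((hf.hasW_Y hw).linearMap (cx A)).unique
      (((hbW w hw).smul (hHW w hw)).congr hΩ hw fun v hv => (hZ v hv).1)
  have hHzb : ∀ w ∈ Ω, HasW (dz H) (dz (dz H) w) (dzbar (dz H) w) w :=
    fun w hw => (hH.dz hΩ).hasW hΩ hw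
  have hYzzb : ∀ w ∈ Ω, cx A (dzbar (dz (Y f)) w) =
      dzbar (dz b) w • H w + dz b w • dzbar H w + (dzbar b w • dz H w + b w • dzbar (dz H) w) :=
    fun w hw => (((hf.hasW_Yz hw).linearMap (cx A)).unique
      (((((hbs.dz hΩ).hasW hΩ hw).smul (hHW w hw)).add ((hbW w hw).smul
        (hHzb w hw))).congr hΩ hw fun v hv => (hYz v hv).1)).2
  have hHH : ∀ w ∈ Ω, mink (H w) (H w) = 0 := by
    intro w hw
    have e := mink_cx hA (Y f w) (Y f w)
    rw [(hZ w hw).1, mink_smul_left, mink_smul_right, hf.Y_Y hw] at e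
    simpa [(hZ w hw).2] using e
  have hHHz : ∀ w ∈ Ω, mink (H w) (dz H w) = 0 ∧ mink (H w) (dzbar H w) = 0 := by
    intro w hw
    have e := ((hHW w hw).mink (hHW w hw)).unique ((hasW_const 0 w).congr hΩ hw hHH)
    simp only [mink_comm _ (H w)] at e
    exact ⟨by linear_combination e.1 / 2, by linear_combination e.2 / 2⟩
  -- The last four entries of H are harmonic and the first two differ by a constant.
  have hH2 : ∀ w ∈ Ω, dzbar (dz H) w = dzbar (dz H) w 0 • rc poleVec := by
    intro w hw
    have hd := dzbar_dz_holomorphic hΩ hh hJ hol hw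
    have hcomp : ∀ (i : Fin 6), dzbar (dz H) w i = dzbar (dz fun v => H v i) w := by
      intro i
      rw [← ((hHzb w hw).apply i).2.2]
      exact ((((hH.apply i).dz hΩ).hasW hΩ hw).congr hΩ hw
        fun v hv => ((hHW v hv).apply i).2.1.symm).2.2
    funext i
    refine Fin.cases ?_ (fun j => Fin.cases ?_ (fun k => ?_) j) i
    · simp [rc, poleVec]
    · simp only [hcomp, rc, poleVec, Pi.smul_apply, Fin.cons_succ, Fin.cons_zero,
        Complex.ofReal_one, smul_eq_mul, mul_one]
      have e : ∀ v ∈ Ω, H v (Fin.succ 0) = H v 0 - 2 := by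
        intro v _
        simp [H_def, rc, stereoLift]; ring
      have e1 : ∀ v ∈ Ω, dz (fun u => H u (Fin.succ 0)) v = dz (fun u => H u 0) v := by
        intro v hv
        have := ((((hH.apply 0).hasW hΩ hv).sub (hasW_const 2 v)).congr hΩ hv e).2.1
        rwa [sub_zero] at this
      exact ((((hH.apply 0).dz hΩ).hasW hΩ hw).congr hΩ hw e1).2.2
    · have e : ∀ v ∈ Ω, dz H v k.succ.succ = 2 * (dz (fun u => rc (h u).ofLp) v) k := by
        intro v hv
        have hs : SmoothOn (fun u => rc (h u).ofLp) Ω := SmoothOn.of_pi fun i =>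
          SmoothOn.ofReal ((EuclideanSpace.proj i : _ →L[ℝ] ℝ).contDiff.comp_contDiffOn hh)
        rw [← ((hHW v hv).apply k.succ.succ).2.1]
        exact ((((hs.hasW hΩ hv).apply k).const_mul 2).congr hΩ hv fun u _ => by
          simp [H_def, rc, stereoLift]).2.1
      have hs : SmoothOn (fun u => rc (h u).ofLp) Ω := SmoothOn.of_pi fun i =>
        SmoothOn.ofReal ((EuclideanSpace.proj i : _ →L[ℝ] ℝ).contDiff.comp_contDiffOn hh)
      have e2 := (((((hs.dz hΩ).hasW hΩ hw).apply k).const_mul 2).congr hΩ hw e).2.2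
      rw [hd] at e2
      rw [← ((hHzb w hw).apply k.succ.succ).2.2, e2]
      simp [rc, poleVec]
  -- If H_zz̄ = 0, differentiating ⟨H, H_z⟩ = 0 gives ⟨H_z, H_z̄⟩ = 0, contradicting ⟨Y_z, Y_z̄⟩ =
  -- 1/2.
  have hγ : ∀ w ∈ Ω, dzbar (dz H) w 0 ≠ 0 := by
    intro w hw h0
    have e0 := hH2 w hw
    rw [h0, zero_smul] at e0
    have e1 := (((hHW w hw).mink (hHzb w hw)).unique
      ((hasW_const 0 w).congr hΩ hw fun v hv => (hHHz v hv).1)).2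
    rw [e0, mink_zero_right, add_zero] at e1
    have e2 := mink_cx hA (dz (Y f) w) (dzbar (Y f) w)
    rw [hf.Yz_Yzb hw, (hYz w hw).1, (hYz w hw).2] at e2
    have e3 := (hHHz w hw).1
    rw [mink_comm] at e1 e3
    simp only [mink_add_left, mink_add_right, mink_smul_left, mink_smul_right, hHH w hw, e1, e3,
      (hHHz w hw).2] at e2
    norm_num at e2
  -- Orthogonality of κ to Y, Y_z, Y_z̄, Y_zz̄ passes in turn to H, H_z, H_z̄, H_zz̄, and the last
  -- is a nonzero multiple of the pole vector.
  have hκ : ∀ w ∈ Ω, mink (cx A (kappa f w)) (rc poleVec) = 0 := by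
    intro w hw
    obtain ⟨k1, k2, k3, -⟩ := hf.kappa_orth hw
    have k4 := hf.kappa_Yzzb hw
    have hb := (hZ w hw).2
    rw [← mink_cx hA, (hZ w hw).1, mink_smul_right] at k1
    have k1' := (mul_eq_zero.1 k1).resolve_left hb
    rw [← mink_cx hA, (hYz w hw).1, mink_add_right, mink_smul_right, mink_smul_right, k1',
      mul_zero, zero_add] at k2
    have k2' := (mul_eq_zero.1 k2).resolve_left hb
    rw [← mink_cx hA, (hYz w hw).2, mink_add_right, mink_smul_right, mink_smul_right, k1',
      mul_zero, zero_add] at k3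
    have k3' := (mul_eq_zero.1 k3).resolve_left hb
    rw [← mink_cx hA, hYzzb w hw, hH2 w hw] at k4
    simp only [mink_add_right, mink_smul_right, k1', k2', k3', mul_zero, zero_add, add_zero] at k4
    exact (mul_eq_zero.1 ((mul_eq_zero.1 k4).resolve_left hb)).resolve_left (hγ w hw)
  -- An isometry of a nondegenerate form is injective, hence surjective in finite dimension, so the
  -- pole vector can be pulled back by A.
  have hinj : Function.Injective A := by
    rw [injective_iff_map_eq_zero]
    intro X hX
    have hall : ∀ X', mink X X' = 0 := fun X' => by rw [← hA, hX, mink_zero_left]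
    funext i
    refine Fin.cases ?_ (fun j => ?_) i
    · simpa [mink, Pi.single_apply] using hall (Pi.single 0 1)
    · have e := hall (Pi.single j.succ 1)
      simpa [mink, Pi.single_apply, (Fin.succ_ne_zero j).symm] using e
  obtain ⟨X0, hX0⟩ := LinearMap.injective_iff_surjective.1 hinj poleVec
  have hE : cx A (rc X0) = rc poleVec := by rw [cx_rc, hX0]
  refine hf.dzbar_mu_of_null (E := rc X0) (vconj_rc _) ?_ ?_ ?_ hz
  · rw [← mink_cx hA, hE, mink_rc_poleVec]
    rw [show (1 : Fin 6) = Fin.succ 0 from rfl]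
    simp [rc, poleVec]
  · intro w hw
    rw [← mink_cx hA, hE, hκ w hw]
  · intro w hw
    rw [← mink_cx hA, hE, (hZ w hw).1, mink_smul_left, hHe]
    exact mul_ne_zero (hZ w hw).2 (by norm_num)

end IsoOn

/-! ### The parallel complex structure -/

theorem eq_of_hasW_zero {W : Type*} [NormedAddCommGroup W] [NormedSpace ℂ W] {F : ℂ → W}
    {Ω : Set ℂ} (hΩ : IsOpen Ω) (hc : Convex ℝ Ω) (h : ∀ z ∈ Ω, HasW F 0 0 z) {z w : ℂ}
    (hz : z ∈ Ω) (hw : w ∈ Ω) : F z = F w := by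
  refine hΩ.is_const_of_fderiv_eq_zero hc.isPreconnected
    (fun v hv => (h v hv).1.differentiableWithinAt) (fun v hv => ?_) hz hw
  ext t
  have e : t = t.re • (1 : ℂ) + t.im • Complex.I := by
    simp [Complex.re_add_im]
  rw [e, map_add, map_smul, map_smul, fderiv_one_eq, fderiv_I_eq, (h v hv).2.1, (h v hv).2.2]
  simp

section ComplexStructure

variable {p q : Fin 4 → ℂ} {a b : ℂ}

/-- Entry of the Hermitian projector onto the span of the orthogonal vectors `p`, `q` with
`|p|² = a`, `|q|² = b`. -/
def projEntry (a b : ℂ) (p q : Fin 4 → ℂ) (i j : Fin 4) : ℂ :=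
  a⁻¹ * (p i * conj (p j)) + b⁻¹ * (q i * conj (q j))

/-- The projector onto the span of `p`, `q`. -/
def projVec (a b : ℂ) (p q v : Fin 4 → ℂ) : Fin 4 → ℂ :=
  (a⁻¹ * (vconj p ⬝ᵥ v)) • p + (b⁻¹ * (vconj q ⬝ᵥ v)) • q

theorem projVec_apply (v : Fin 4 → ℂ) (i : Fin 4) :
    projVec a b p q v i = ∑ j, projEntry a b p q i j * v j := by
  simp only [projVec, projEntry, Pi.add_apply, Pi.smul_apply, smul_eq_mul, dotProduct, vconj,
    add_mul, Finset.sum_add_distrib, Finset.mul_sum, Finset.sum_mul]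
  congr 1 <;> exact Finset.sum_congr rfl fun j _ => by ring

/-- `p`, `q` is an orthogonal basis of a maximal isotropic subspace of `ℂ⁴`. -/
structure IsotropicBasis (a b : ℂ) (p q : Fin 4 → ℂ) : Prop where
  pp : p ⬝ᵥ p = 0
  pq : p ⬝ᵥ q = 0
  qq : q ⬝ᵥ q = 0
  pcp : p ⬝ᵥ vconj p = a
  pcq : p ⬝ᵥ vconj q = 0
  qcq : q ⬝ᵥ vconj q = b
  a_ne : a ≠ 0
  b_ne : b ≠ 0

theorem vconj_dotProduct (v w : Fin 4 → ℂ) : vconj v ⬝ᵥ vconj w = conj (v ⬝ᵥ w) := by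
  simp [dotProduct, vconj, map_sum]

namespace IsotropicBasis

variable (H : IsotropicBasis a b p q)
include H

theorem cpcp : vconj p ⬝ᵥ vconj p = 0 := by rw [vconj_dotProduct, H.pp, map_zero]
theorem cpcq : vconj p ⬝ᵥ vconj q = 0 := by rw [vconj_dotProduct, H.pq, map_zero]
theorem cqcq : vconj q ⬝ᵥ vconj q = 0 := by rw [vconj_dotProduct, H.qq, map_zero]
theorem cpq : vconj p ⬝ᵥ q = 0 := by
  rw [← vconj_vconj q, vconj_dotProduct, H.pcq, map_zero]
theorem conj_a : conj a = a := by
  rw [← H.pcp, ← vconj_dotProduct, vconj_vconj, dotProduct_comm]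
theorem conj_b : conj b = b := by
  rw [← H.qcq, ← vconj_dotProduct, vconj_vconj, dotProduct_comm]

theorem vconj_projVec (v : Fin 4 → ℂ) : vconj (projVec a b p q v) =
    (a⁻¹ * (p ⬝ᵥ vconj v)) • vconj p + (b⁻¹ * (q ⬝ᵥ vconj v)) • vconj q := by
  rw [projVec, vconj_add, vconj_smul, vconj_smul, map_mul, map_mul, map_inv₀, map_inv₀, H.conj_a,
    H.conj_b, ← vconj_dotProduct, ← vconj_dotProduct, vconj_vconj, vconj_vconj]

/-- By the isotropy and orthogonality relations p, q, p̄, q̄ is a basis of ℂ⁴ whose dual functionals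
are p̄/a, q̄/b, p/a, q/b. The two conjugate planes therefore split ℂ⁴. -/
theorem complete {v : Fin 4 → ℂ} (hv : vconj v = v) :
    v = projVec a b p q v + vconj (projVec a b p q v) := by
  have ha := H.a_ne
  have hb := H.b_ne
  have h := eq_sum_of_biorthogonal ![p, q, vconj p, vconj q]
    ![dotProductBilin ℂ ℂ (a⁻¹ • vconj p), dotProductBilin ℂ ℂ (b⁻¹ • vconj q),
      dotProductBilin ℂ ℂ (a⁻¹ • p), dotProductBilin ℂ ℂ (b⁻¹ • q)] (by
    intro i j
    fin_cases i <;> fin_cases j <;>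
      simp [H.pp, H.pq, H.qq, H.pcp, H.pcq, H.qcq, H.cpcp, H.cpcq, H.cqcq, H.cpq,
        dotProduct_comm q p, dotProduct_comm (vconj p) p, dotProduct_comm (vconj q) p,
        dotProduct_comm (vconj q) q, dotProduct_comm q (vconj p),
        dotProduct_comm (vconj q) (vconj p), ha, hb]) v
  rw [H.vconj_projVec, hv, projVec]
  refine h.trans ((Fin.sum_univ_four _).trans ?_)
  simp
  module

theorem projVec_projVec (v : Fin 4 → ℂ) :
    projVec a b p q (projVec a b p q v) = projVec a b p q v := by
  have ha := H.a_ne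
  have hb := H.b_ne
  have e1 : vconj p ⬝ᵥ p = a := by rw [dotProduct_comm, H.pcp]
  have e2 : vconj q ⬝ᵥ p = 0 := by rw [dotProduct_comm, H.pcq]
  have e3 : vconj q ⬝ᵥ q = b := by rw [dotProduct_comm, H.qcq]
  rw [projVec, projVec]
  simp only [dotProduct_add, dotProduct_smul, smul_eq_mul, e1, e2, e3, H.cpq]
  congr 2
  · field_simp; ring
  · field_simp; ring

theorem projVec_vconj (v : Fin 4 → ℂ) :
    projVec a b p q (vconj (projVec a b p q v)) = 0 := by
  have e2 : vconj q ⬝ᵥ vconj p = 0 := by rw [dotProduct_comm, H.cpcq]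
  rw [H.vconj_projVec, projVec]
  simp only [dotProduct_add, dotProduct_smul, smul_eq_mul, H.cpcp, H.cpcq, H.cqcq, e2]
  simp

theorem projVec_dotProduct (v w : Fin 4 → ℂ) :
    projVec a b p q v ⬝ᵥ projVec a b p q w = 0 := by
  have e2 : q ⬝ᵥ p = 0 := by rw [dotProduct_comm, H.pq]
  rw [projVec, projVec]
  simp only [dotProduct_add, add_dotProduct, smul_dotProduct, dotProduct_smul, smul_eq_mul, H.pp,
    H.pq, H.qq, e2]
  simp

theorem projVec_p : projVec a b p q p = p := by
  have ha := H.a_ne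
  have e1 : vconj p ⬝ᵥ p = a := by rw [dotProduct_comm, H.pcp]
  have e2 : vconj q ⬝ᵥ p = 0 := by rw [dotProduct_comm, H.pcq]
  rw [projVec, e1, e2]
  simp [ha]

theorem projVec_cp : projVec a b p q (vconj p) = 0 := by
  have e2 : vconj q ⬝ᵥ vconj p = 0 := by rw [dotProduct_comm, H.cpcq]
  rw [projVec, H.cpcp, e2]
  simp

end IsotropicBasis

/-- The complex structure on `ℝ⁴` with `i`-eigenspace spanned by `p`, `q`. -/
def complexStructure (a b : ℂ) (p q : Fin 4 → ℂ) :
    EuclideanSpace ℝ (Fin 4) →ₗ[ℝ] EuclideanSpace ℝ (Fin 4) :=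
  -- With P the projector, i (P - P̄) is real with entries -2 Im P_ij.
  Matrix.toEuclideanLin (Matrix.of fun i j => -2 * (projEntry a b p q i j).im)

theorem rc_complexStructure (v : EuclideanSpace ℝ (Fin 4)) :
    rc (complexStructure a b p q v).ofLp =
      Complex.I • (projVec a b p q (rc v.ofLp) - vconj (projVec a b p q (rc v.ofLp))) := by
  funext i
  have e1 : (complexStructure a b p q v).ofLp i = -2 * (projVec a b p q (rc v.ofLp) i).im := by
    rw [projVec_apply, Complex.im_sum, Finset.mul_sum]
    simp only [complexStructure, Matrix.toEuclideanLin, Matrix.toLpLin_apply, Matrix.mulVec,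
      dotProduct, Matrix.of_apply, rc, Complex.im_mul_ofReal]
    exact Finset.sum_congr rfl fun j _ => by ring
  simp only [rc, Pi.smul_apply, Pi.sub_apply, vconj, smul_eq_mul, Complex.sub_conj]
  rw [e1]
  push_cast
  linear_combination -2 * ((projVec a b p q (rc v.ofLp) i).im : ℂ) * Complex.I_mul_I

theorem rc_injective {m : ℕ} : Function.Injective (rc : (Fin m → ℝ) → (Fin m → ℂ)) :=
  fun _ _ h => funext fun i => Complex.ofReal_injective (congrFun h i)

theorem rc_inner {m : ℕ} (v w : EuclideanSpace ℝ (Fin m)) :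
    ((inner ℝ v w : ℝ) : ℂ) = rc v.ofLp ⬝ᵥ rc w.ofLp := by
  rw [inner_eq_sum]
  simp [rc, dotProduct]

theorem projVec_add (v w : Fin 4 → ℂ) :
    projVec a b p q (v + w) = projVec a b p q v + projVec a b p q w := by
  simp only [projVec, dotProduct_add]; module

theorem projVec_smul (c : ℂ) (v : Fin 4 → ℂ) :
    projVec a b p q (c • v) = c • projVec a b p q v := by
  simp only [projVec, dotProduct_smul, smul_eq_mul]; module

theorem projVec_sub (v w : Fin 4 → ℂ) :
    projVec a b p q (v - w) = projVec a b p q v - projVec a b p q w := by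
  simp only [projVec, dotProduct_sub]; module

/-- The operator is i on the plane of p, q and -i on its conjugate, so it squares to -1. Both planes
are isotropic, so the bilinear form pairs only one with the other, where the eigenvalues multiply to
i (-i) = 1. -/
theorem isOrthogonalComplexStructure_complexStructure (H : IsotropicBasis a b p q) :
    IsOrthogonalComplexStructure (complexStructure a b p q) := by
  refine ⟨fun v => ?_, fun v w => ?_⟩
  · apply WithLp.ofLp_injective 2
    apply rc_injective
    have hv := H.complete (vconj_rc v.ofLp)
    have e : rc (-v).ofLp = -rc v.ofLp := by funext i; simp [rc]
    rw [rc_complexStructure, rc_complexStructure, e, projVec_smul, projVec_sub, H.projVec_projVec,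
      H.projVec_vconj, sub_zero, vconj_smul, Complex.conj_I]
    nth_rewrite 3 [hv]
    rw [smul_sub, smul_smul, smul_smul, mul_neg, Complex.I_mul_I]
    module
  · have hv := H.complete (vconj_rc v.ofLp)
    have hw := H.complete (vconj_rc w.ofLp)
    have e1 := H.projVec_dotProduct (rc v.ofLp) (rc w.ofLp)
    have e2 : vconj (projVec a b p q (rc v.ofLp)) ⬝ᵥ vconj (projVec a b p q (rc w.ofLp)) = 0 := by
      rw [vconj_dotProduct, e1, map_zero]
    apply Complex.ofReal_injective
    rw [rc_inner, rc_inner, rc_complexStructure, rc_complexStructure]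
    conv_rhs => rw [hv, hw]
    simp only [smul_dotProduct, dotProduct_smul, sub_dotProduct, dotProduct_sub, add_dotProduct,
      dotProduct_add, e1, e2, smul_eq_mul]
    linear_combination -(projVec a b p q (rc v.ofLp) ⬝ᵥ vconj (projVec a b p q (rc w.ofLp)) +
      vconj (projVec a b p q (rc v.ofLp)) ⬝ᵥ projVec a b p q (rc w.ofLp)) * Complex.I_mul_I

theorem complexStructure_apply_p (H : IsotropicBasis a b p q) {x y : EuclideanSpace ℝ (Fin 4)}
    (hx : rc x.ofLp = p + vconj p) (hy : rc y.ofLp = Complex.I • (p - vconj p)) :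
    y = complexStructure a b p q x := by
  apply WithLp.ofLp_injective 2
  apply rc_injective
  rw [rc_complexStructure, hx, hy, projVec_add, H.projVec_p, H.projVec_cp, add_zero]

/-- The complex structure is constant if `p`, `q` solve a suitable linear system. -/
theorem complexStructure_eq {Ω : Set ℂ} (hΩ : IsOpen Ω) (hc : Convex ℝ Ω) {p q : ℂ → Fin 4 → ℂ}
    {a b k μ β a' b' : ℂ → ℂ} (H : ∀ z ∈ Ω, IsotropicBasis (a z) (b z) (p z) (q z))
    (hk : ∀ z ∈ Ω, conj (k z) = k z) (hab : ∀ z ∈ Ω, b z = 2 * k z * a z)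
    (hp : ∀ z ∈ Ω, HasW p (μ z • p z + q z) 0 z)
    (hq : ∀ z ∈ Ω, HasW q (β z • q z) (-(2 * k z) • p z) z)
    (ha : ∀ z ∈ Ω, HasW a (μ z * a z) (a' z) z) (hb : ∀ z ∈ Ω, HasW b (β z * b z) (b' z) z)
    {z w : ℂ} (hz : z ∈ Ω) (hw : w ∈ Ω) :
    complexStructure (a z) (b z) (p z) (q z) = complexStructure (a w) (b w) (p w) (q w) := by
  -- In ∂_z of the projector the rates μ and β of p, q cancel against those of a, b. The cross term
  -- q p̄ has coefficient 1/a - 2k/b, which vanishes because b = 2ka.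
  have hd : ∀ i j, ∀ v ∈ Ω, ∃ t, HasW (fun v => projEntry (a v) (b v) (p v) (q v) i j) 0 t v := by
    intro i j v hv
    have hav := (H v hv).a_ne
    have hbv := (H v hv).b_ne
    have hkv : k v ≠ 0 := fun h => hbv (by rw [hab v hv, h]; ring)
    have h1 := (((ha v hv).inv hav).mul (((hp v hv).apply i).mul ((hp v hv).apply j).conjugate)).add
      (((hb v hv).inv hbv).mul (((hq v hv).apply i).mul ((hq v hv).apply j).conjugate))
    refine ⟨_, h1.1, h1.2.1.trans ?_, rfl⟩
    simp only [Pi.add_apply, Pi.smul_apply, smul_eq_mul, Pi.zero_apply, map_mul, map_neg, map_zero,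
      hk v hv, Complex.conj_ofNat]
    rw [hab v hv]
    field_simp
    ring
  -- The projector is Hermitian, so its z̄-derivative vanishes with its z-derivative; this is why a'
  -- and b' are arbitrary.
  have hd2 : ∀ i j, ∀ v ∈ Ω, HasW (fun v => projEntry (a v) (b v) (p v) (q v) i j) 0 0 v := by
    intro i j v hv
    obtain ⟨t, ht⟩ := hd i j v hv
    obtain ⟨t', ht'⟩ := hd j i v hv
    have h2 := ht'.conjugate.congr hΩ hv (G := fun v => projEntry (a v) (b v) (p v) (q v) i j)
      fun u hu => by
        simp only [projEntry, map_add, map_mul, map_inv₀, (H u hu).conj_a, (H u hu).conj_b,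
          Complex.conj_conj]
        ring
    have h3 := (ht.unique h2).2
    rw [map_zero] at h3
    rwa [h3] at ht
  rw [complexStructure, complexStructure]
  congr 2
  funext i j
  rw [eq_of_hasW_zero hΩ hc (hd2 i j) hz hw]

end ComplexStructure

/-! ### From `𝒫 = 0` to complex curves -/

/-- The linear map of Minkowski space induced by a linear isometry of the space-like part. -/
def rotLift {m : ℕ} (R : EuclideanSpace ℝ (Fin m) ≃ₗᵢ[ℝ] EuclideanSpace ℝ (Fin m)) :
    (Fin (m + 1) → ℝ) →ₗ[ℝ] (Fin (m + 1) → ℝ) where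
  toFun X := Fin.cons (X 0) (R (WithLp.toLp 2 fun i => X i.succ)).ofLp
  map_add' X X' := by
    have e : (WithLp.toLp 2 fun i : Fin m => (X + X') i.succ) =
      WithLp.toLp 2 (fun i : Fin m => X i.succ) + WithLp.toLp 2 (fun i : Fin m => X' i.succ) := rfl
    rw [e, map_add]
    funext i
    refine Fin.cases ?_ (fun j => ?_) i <;> simp
  map_smul' c X := by
    have e : (WithLp.toLp 2 fun i : Fin m => (c • X) i.succ) =
      c • WithLp.toLp 2 (fun i : Fin m => X i.succ) := rfl
    rw [e, map_smul]
    funext i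
    refine Fin.cases ?_ (fun j => ?_) i <;> simp

section RotLift

variable {m : ℕ} (R : EuclideanSpace ℝ (Fin m) ≃ₗᵢ[ℝ] EuclideanSpace ℝ (Fin m))

theorem rotLift_nullLift (x : EuclideanSpace ℝ (Fin m)) :
    rotLift R (nullLift x) = nullLift (R x) := by
  funext i
  refine Fin.cases ?_ (fun j => ?_) i
  · simp [rotLift, nullLift]
  · simp only [rotLift, LinearMap.coe_mk, AddHom.coe_mk, Fin.cons_succ, nullLift]

theorem mink_rotLift (X X' : Fin (m + 1) → ℝ) : mink (rotLift R X) (rotLift R X') = mink X X' := by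
  have h := R.inner_map_map (WithLp.toLp 2 fun i => X i.succ) (WithLp.toLp 2 fun i => X' i.succ)
  rw [inner_eq_sum, inner_eq_sum] at h
  simp only [mink, rotLift, LinearMap.coe_mk, AddHom.coe_mk, Fin.cons_succ, Fin.cons_zero, h]

end RotLift

/-- Stereographic projection of `ℝ^(m+1)` from the pole `(1, 0, …, 0)`. -/
def stereo {m : ℕ} (w : EuclideanSpace ℝ (Fin (m + 1))) : EuclideanSpace ℝ (Fin m) :=
  WithLp.toLp 2 fun i => w i.succ / (1 - w 0)

theorem invStereoVec_stereo {m : ℕ} {w : EuclideanSpace ℝ (Fin (m + 1))} (hw : ‖w‖ = 1)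
    (h0 : w 0 ≠ 1) : invStereoVec (stereo w) = w := by
  have h1 : 1 - w 0 ≠ 0 := sub_ne_zero.2 (Ne.symm h0)
  have h2 : w 0 ^ 2 + ∑ i : Fin m, w i.succ ^ 2 = 1 := by
    rw [← Fin.sum_univ_succ (fun i => w i ^ 2), ← EuclideanSpace.real_norm_sq_eq, hw, one_pow]
  have h3 : ‖stereo w‖ ^ 2 = (1 + w 0) / (1 - w 0) := by
    rw [EuclideanSpace.real_norm_sq_eq]
    simp only [stereo, div_pow]
    rw [← Finset.sum_div, div_eq_div_iff (pow_ne_zero 2 h1) h1]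
    linear_combination (1 - w 0) * h2
  have h4 : ‖stereo w‖ ^ 2 + 1 = 2 / (1 - w 0) := by rw [h3]; field_simp; ring
  have h5 : ‖stereo w‖ ^ 2 - 1 = 2 * w 0 / (1 - w 0) := by rw [h3]; field_simp; ring
  apply WithLp.ofLp_injective 2
  funext i
  refine Fin.cases ?_ (fun j => ?_) i
  · simp only [invStereoVec, Fin.cons_zero, h4, h5]; field_simp
  · simp only [invStereoVec, Fin.cons_succ, h4]
    simp only [stereo]
    field_simp

theorem contDiffOn_stereo {m : ℕ} {g : ℂ → EuclideanSpace ℝ (Fin (m + 1))} {Ω : Set ℂ}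
    (hg : ContDiffOn ℝ ∞ g Ω) (h0 : ∀ z ∈ Ω, g z 0 ≠ 1) :
    ContDiffOn ℝ ∞ (fun z => stereo (g z)) Ω := by
  have hcoord : ∀ i, ContDiffOn ℝ ∞ (fun z => g z i) Ω := fun i =>
    (EuclideanSpace.proj i : _ →L[ℝ] ℝ).contDiff.comp_contDiffOn hg
  rw [contDiffOn_euclidean]
  intro i
  have h : ContDiffOn ℝ ∞ (fun z => g z i.succ / (1 - g z 0)) Ω :=
    (hcoord i.succ).div (contDiffOn_const.sub (hcoord 0)) fun z hz =>
      sub_ne_zero.2 (Ne.symm (h0 z hz))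
  exact h

namespace IsoOn

variable {f : ℂ → EuclideanSpace ℝ (Fin 5)} {Ω : Set ℂ} {z : ℂ}

/-- The null section of `V` which spans a constant line if `𝒫 = 0`. -/
def nullSection (f : ℂ → EuclideanSpace ℝ (Fin 5)) (z : ℂ) : Fin 6 → ℂ :=
  -- The coefficients are those forced by the relations in `dzbar_mu_of_null` when the section is
  -- normalized to have product -1 with Y.
  N f z + (1 / 2 * (mu f z * conj (mu f z))) • Y f z + conj (mu f z) • dz (Y f) z
    + mu f z • dzbar (Y f) z

theorem vconj_nullSection (hf : IsoOn f Ω) (hz : z ∈ Ω) :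
    vconj (nullSection f z) = nullSection f z := by
  have h : vconj (dzbar (Y f) z) = dz (Y f) z := by rw [hf.dzbar_Y hz, vconj_vconj]
  simp only [nullSection, vconj_add, vconj_smul, hf.vconj_N hz, ConfOn.vconj_Y, h,
    ← hf.dzbar_Y hz, map_mul, map_div₀, map_one, Complex.conj_conj, Complex.conj_ofNat,
    mul_comm (conj (mu f z))]
  abel

/-- Inserting Codazzi, Gauss and 𝒫 = 0 into the z-derivative cancels the κ-terms and leaves a
multiple of the section. The z̄-derivative follows because the section is real. -/
theorem hasW_nullSection (hf : IsoOn f Ω) (hP : ∀ w ∈ Ω, dzbar (mu f) w = 2 * kappaSq f w)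
    (hz : z ∈ Ω) : HasW (nullSection f) ((mu f z / 2) • nullSection f z)
      ((conj (mu f z) / 2) • nullSection f z) z := by
  have hμ := hf.hasW_mu hz
  have hY := hf.hasW_Y hz
  have h := (((hf.hasW_N hz).add (((hμ.mul hμ.conjugate).const_mul (1 / 2)).smul hY)).add
    (hμ.conjugate.smul (hf.hasW_Yz hz))).add (hμ.smul (hf.hasW_Yzb hz))
  have h1 : dz (nullSection f) z = (mu f z / 2) • nullSection f z := by
    refine h.2.1.trans ?_
    have hs : dz (mu f) z = schw f z + mu f z ^ 2 / 2 := by rw [hf.schw_eq hz]; ring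
    rw [hs, hP z hz, hf.dzbar_schw hz, hf.dzbar_kappa hz, hf.Yzz_eq hz, hf.Yzzb_eq hz,
      nullSection, map_mul, ConfOn.kappaSq_conj, Complex.conj_ofNat]
    module
  have h2 : dzbar (nullSection f) z = (conj (mu f z) / 2) • nullSection f z := by
    have h3 : HasW (nullSection f) (dz (nullSection f) z) (dzbar (nullSection f) z) z :=
      ⟨h.1, rfl, rfl⟩
    rw [(h3.vconj.congr hf.isOpen hz fun w hw => (hf.vconj_nullSection hw).symm).2.2, h1,
      vconj_smul, hf.vconj_nullSection hz, map_div₀, Complex.conj_ofNat]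
  exact ⟨h.1, h1, h2⟩

theorem nullSection_products (hf : IsoOn f Ω) (hz : z ∈ Ω) :
    mink (nullSection f z) (nullSection f z) = 0 ∧ mink (Y f z) (nullSection f z) = -1 ∧
      mink (dz (Y f) z) (nullSection f z) = mu f z / 2 ∧
      mink (kappa f z) (nullSection f z) = 0 := by
  have a1 := hf.Y_Y hz
  have a2 := (hf.Y_Yz hz).1
  have a3 := (hf.Y_Yz hz).2
  have a4 := hf.Yz_Yz hz
  have a5 := hf.Yz_Yzb hz
  have a6 : mink (dzbar (Y f) z) (dzbar (Y f) z) = 0 := by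
    rw [hf.dzbar_Y hz, mink_vconj, a4, map_zero]
  have a7 := hf.N_Y hz
  have a8 := hf.N_N hz
  have a9 := hf.N_Yz hz
  have a10 := hf.N_Yzb hz
  obtain ⟨k1, k2, k3, k4⟩ := hf.kappa_orth hz
  have b2 := a2; have b3 := a3; have b5 := a5; have b7 := a7; have b9 := a9; have b10 := a10
  rw [mink_comm] at b2 b3 b5 b7 b9 b10
  simp only [nullSection, mink_add_left, mink_add_right, mink_smul_left, mink_smul_right, a1, a2,
    a3, a4, a5, a6, a7, a8, a9, a10, k1, k2, k3, k4, b2, b3, b5, b7, b9, b10]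
  refine ⟨?_, ?_, ?_, ?_⟩ <;> ring

/-- A real null vector without time component is zero, which is excluded by the product -1 with Y.
-/
theorem nullSection_zero_ne (hf : IsoOn f Ω) (hz : z ∈ Ω) : nullSection f z 0 ≠ 0 := by
  intro h0
  obtain ⟨h1, h2, -, -⟩ := hf.nullSection_products hz
  have hr : ∀ i, nullSection f z i = ((nullSection f z i).re : ℂ) := fun i =>
    (Complex.conj_eq_iff_re.1 (congrFun (hf.vconj_nullSection hz) i)).symm
  have h3 : ∑ i : Fin 5, (nullSection f z i.succ).re ^ 2 = 0 := by
    rw [mink, h0] at h1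
    have : ((∑ i : Fin 5, (nullSection f z i.succ).re ^ 2 : ℝ) : ℂ) = 0 := by
      rw [← h1]
      push_cast
      simp only [← hr]
      simp [pow_two]
    exact_mod_cast this
  have h4 := (Finset.sum_eq_zero_iff_of_nonneg (fun i _ => sq_nonneg _)).1 h3
  have h5 : nullSection f z = 0 := by
    funext i
    refine Fin.cases h0 (fun j => ?_) i
    rw [hr, pow_eq_zero_iff two_ne_zero |>.1 (h4 j (Finset.mem_univ j))]
    rfl
  rw [h5, mink_zero_right] at h2
  norm_num at h2

/-- If `𝒫 = 0`, the null section spans the line of a fixed point `u` of the sphere. -/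
theorem exists_fixed_point (hf : IsoOn f Ω) (hc : Convex ℝ Ω)
    (hP : ∀ w ∈ Ω, dzbar (mu f) w = 2 * kappaSq f w) (hz : z ∈ Ω) :
    ∃ u : EuclideanSpace ℝ (Fin 5), ‖u‖ = 1 ∧
      ∀ w ∈ Ω, nullSection f w = nullSection f w 0 • rc (nullLift u) := by
  -- The section and its time component satisfy the same linear equations, so their quotient is
  -- constant.
  have hE : ∀ w ∈ Ω, HasW (fun w => (nullSection f w 0)⁻¹ • nullSection f w) 0 0 w := by
    intro w hw
    have h0 := hf.nullSection_zero_ne hw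
    have hX := hf.hasW_nullSection hP hw
    have h := ((hX.apply 0).inv h0).smul hX
    convert h using 1
    · simp only [Pi.smul_apply, smul_eq_mul, smul_smul]
      rw [← add_smul]
      have : -(mu f w / 2 * nullSection f w 0) / nullSection f w 0 ^ 2 +
        (nullSection f w 0)⁻¹ * (mu f w / 2) = 0 := by field_simp; ring
      rw [this, zero_smul]
    · simp only [Pi.smul_apply, smul_eq_mul, smul_smul]
      rw [← add_smul]
      have : -(conj (mu f w) / 2 * nullSection f w 0) / nullSection f w 0 ^ 2 +
        (nullSection f w 0)⁻¹ * (conj (mu f w) / 2) = 0 := by field_simp; ring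
      rw [this, zero_smul]
  have h0 := hf.nullSection_zero_ne hz
  set E : Fin 6 → ℂ := (nullSection f z 0)⁻¹ • nullSection f z with E_def
  have hEr : vconj E = E := by
    have e : conj (nullSection f z 0) = nullSection f z 0 :=
      congrFun (hf.vconj_nullSection hz) 0
    rw [E_def, vconj_smul, hf.vconj_nullSection hz, map_inv₀, e]
  have hE0 : E 0 = 1 := by simp [E_def, h0]
  set u : EuclideanSpace ℝ (Fin 5) := WithLp.toLp 2 fun i => (E i.succ).re with u_def
  have hEu : E = rc (nullLift u) := by
    funext i
    refine Fin.cases ?_ (fun j => ?_) i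
    · rw [hE0]; simp [rc, nullLift]
    · rw [← Complex.conj_eq_iff_re.1 (congrFun hEr j.succ)]
      simp [rc, nullLift, u_def]
  refine ⟨u, ?_, fun w hw => ?_⟩
  · have h1 : mink E E = 0 := by
      rw [E_def, mink_smul_left, mink_smul_right, (hf.nullSection_products hz).1]; ring
    rw [hEu, mink_rc] at h1
    have h2 : mink (nullLift u) (nullLift u) = 0 := by exact_mod_cast h1
    simp only [mink, nullLift_zero, nullLift_succ] at h2
    rw [← inner_eq_sum, real_inner_self_eq_norm_sq] at h2
    have h3 : ‖u‖ ^ 2 = 1 := by linarith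
    nlinarith [norm_nonneg u]
  · have e := eq_of_hasW_zero hf.isOpen hc hE hw hz
    rw [← hEu, E_def, ← e, smul_smul, mul_inv_cancel₀ (hf.nullSection_zero_ne hw), one_smul]

/-- The reflection in the hyperplane orthogonal to u - e₀ exchanges the unit vectors u and e₀; it is
the identity if they coincide. -/
theorem exists_rotation (u : EuclideanSpace ℝ (Fin 5)) (hu : ‖u‖ = 1) :
    ∃ R : EuclideanSpace ℝ (Fin 5) ≃ₗᵢ[ℝ] EuclideanSpace ℝ (Fin 5),
      rc (nullLift (R u)) = rc poleVec := by
  refine ⟨Submodule.reflection (Submodule.span ℝ {u - EuclideanSpace.single 0 1})ᗮ, ?_⟩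
  rw [Submodule.reflection_sub (by simp [hu])]
  congr 1
  funext i
  refine Fin.cases ?_ (fun j => Fin.cases ?_ (fun k => ?_) j) i
  · simp [nullLift, poleVec]
  · simp [nullLift, poleVec]
  · simp [nullLift, poleVec]

/-- If `𝒫 = 0`, the surface is, after a rotation and stereographic projection, a complex curve
for some orthogonal complex structure. -/
theorem exists_complexCurve (hf : IsoOn f Ω) (hc : Convex ℝ Ω)
    (hP : ∀ w ∈ Ω, dzbar (mu f) w = 2 * kappaSq f w) (hz : z ∈ Ω) :
    ∃ R : EuclideanSpace ℝ (Fin 5) ≃ₗᵢ[ℝ] EuclideanSpace ℝ (Fin 5),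
    ∃ J : EuclideanSpace ℝ (Fin 4) →ₗ[ℝ] EuclideanSpace ℝ (Fin 4),
      IsOrthogonalComplexStructure J ∧ (∀ w ∈ Ω, R (f w) 0 ≠ 1) ∧
      ∀ w ∈ Ω, fderiv ℝ (fun v => stereo (R (f v))) w Complex.I =
        J (fderiv ℝ (fun v => stereo (R (f v))) w 1) := by
  have hΩ := hf.isOpen
  obtain ⟨u, hu, hX⟩ := hf.exists_fixed_point hc hP hz
  obtain ⟨R, hR⟩ := exists_rotation u hu
  set E : Fin 6 → ℂ := rc (nullLift u) with E_def
  set A := rotLift R with A_def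
  have hA : ∀ X X', mink (cx A X) (cx A X') = mink X X' := mink_cx (mink_rotLift R)
  have hAE : cx A E = rc poleVec := by rw [E_def, cx_rc, A_def, rotLift_nullLift, hR]
  set c : ℂ → ℂ := fun w => nullSection f w 0 with c_def
  have hc0 : ∀ w ∈ Ω, c w ≠ 0 := fun w hw => hf.nullSection_zero_ne hw
  have hcr : ∀ w ∈ Ω, conj (c w) = c w := fun w hw => congrFun (hf.vconj_nullSection hw) 0
  have hcW : ∀ w ∈ Ω, HasW c (mu f w / 2 * c w) (conj (mu f w) / 2 * c w) w := fun w hw =>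
    (hf.hasW_nullSection hP hw).apply 0
  -- the linear projection to `ℂ⁴` with kernel containing `E`
  set L : (Fin 6 → ℂ) →ₗ[ℂ] (Fin 4 → ℂ) :=
    LinearMap.funLeft ℂ ℂ (fun i : Fin 4 => i.succ.succ) ∘ₗ cx A with L_def
  have hLapp : ∀ X i, L X i = cx A X i.succ.succ := fun X i => rfl
  have hLE : L E = 0 := by
    funext i; rw [hLapp, hAE]; simp [rc, poleVec]
  have hLc : ∀ X, vconj (L X) = L (vconj X) := by
    intro X; funext i
    rw [hLapp, ← vconj_cx]; rfl
  -- On E^⊥ the first two coordinates after rotation are equal and cancel in the form, so L realizes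
  -- the isometry of E^⊥/E with ℂ⁴.
  have hLd : ∀ X X', mink X E = 0 → mink X' E = 0 → L X ⬝ᵥ L X' = mink X X' := by
    intro X X' h h'
    rw [← hA, hAE, mink_rc_poleVec] at h h'
    rw [← hA X X']
    simp only [mink, dotProduct, hLapp]
    rw [Fin.sum_univ_succ (n := 4)]
    have e : cx A X (Fin.succ 0) = cx A X 0 := by
      have : (Fin.succ 0 : Fin 6) = 1 := rfl
      rw [this]; linear_combination h
    have e' : cx A X' (Fin.succ 0) = cx A X' 0 := by
      have : (Fin.succ 0 : Fin 6) = 1 := rfl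
      rw [this]; linear_combination h'
    rw [e, e']; ring
  -- This is ∂_z (cY), since c_z = (μ/2) c. It is orthogonal to E because cY has constant product
  -- with E.
  set ph : ℂ → Fin 6 → ℂ := fun w => c w • (dz (Y f) w + (1 / 2 * mu f w) • Y f w) with ph_def
  set qh : ℂ → Fin 6 → ℂ := fun w => c w • kappa f w with qh_def
  have hphE : ∀ w ∈ Ω, mink (ph w) E = 0 := by
    intro w hw
    obtain ⟨-, e1, e2, -⟩ := hf.nullSection_products hw
    rw [hX w hw, mink_smul_right] at e1 e2
    simp only [ph_def, mink_smul_left, mink_add_left]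
    change c w * _ = _ at e1 e2
    linear_combination e2 + (1 / 2 * mu f w) * e1
  have hqhE : ∀ w ∈ Ω, mink (qh w) E = 0 := by
    intro w hw
    obtain ⟨-, -, -, e3⟩ := hf.nullSection_products hw
    rw [hX w hw, mink_smul_right] at e3
    simp only [qh_def, mink_smul_left]
    exact e3
  have hEr : vconj E = E := vconj_rc _
  have hcE : ∀ X, mink X E = 0 → mink (vconj X) E = 0 := by
    intro X h
    rw [← hEr, mink_vconj, h, map_zero]
  -- By 𝒫 = 0 the z̄-derivative is a multiple of the null section, which L kills; modulo E the span
  -- of `ph` and `qh` is closed under both derivatives.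
  have hphW : ∀ w ∈ Ω, HasW ph (mu f w • ph w + qh w) ((c w / 2 * c w) • E) w := by
    intro w hw
    have h := (hcW w hw).smul ((hf.hasW_Yz hw).add
      (((hf.hasW_mu hw).const_mul (1 / 2)).smul (hf.hasW_Y hw)))
    have hs : dz (mu f) w = schw f w + mu f w ^ 2 / 2 := by rw [hf.schw_eq hw]; ring
    refine ⟨h.1, h.2.1.trans ?_, h.2.2.trans ?_⟩
    · rw [hs, hf.Yzz_eq hw]
      simp only [ph_def, qh_def]
      module
    · have e : (c w / 2 * c w) • E = (c w / 2) • nullSection f w := by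
        rw [hX w hw, smul_smul]
      rw [e, hP w hw, hf.Yzzb_eq hw, nullSection]
      module
  have hqhW : ∀ w ∈ Ω, HasW qh ((logDer f w + mu f w) • qh w) (-(2 * kappaSq f w) • ph w) w := by
    intro w hw
    have h := (hcW w hw).smul (hf.hasW_kappa hw)
    refine ⟨h.1, h.2.1.trans ?_, h.2.2.trans ?_⟩
    · rw [hf.dz_kappa_eq hw]
      simp only [qh_def]
      module
    · rw [hf.dzbar_kappa hw]
      simp only [ph_def]
      module
  have hpW : ∀ w ∈ Ω, HasW (fun v => L (ph v)) (mu f w • L (ph w) + L (qh w)) 0 w := by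
    intro w hw
    have h := (hphW w hw).linearMap L
    rwa [map_add, L.map_smul _ (ph w), L.map_smul _ E, hLE, smul_zero] at h
  have hqW : ∀ w ∈ Ω, HasW (fun v => L (qh v)) ((logDer f w + mu f w) • L (qh w))
      (-(2 * kappaSq f w) • L (ph w)) w := by
    intro w hw
    have h := (hqhW w hw).linearMap L
    rwa [L.map_smul _ (qh w), L.map_smul _ (ph w)] at h
  have hB : ∀ w ∈ Ω, IsotropicBasis (1 / 2 * (c w * c w)) (c w * c w * kappaSq f w) (L (ph w))
      (L (qh w)) := by
    intro w hw
    have a1 := hf.Y_Y hw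
    have a2 := (hf.Y_Yz hw).1
    have a3 := (hf.Y_Yz hw).2
    have a4 := hf.Yz_Yz hw
    have a5 := hf.Yz_Yzb hw
    obtain ⟨k1, k2, k3, k4⟩ := hf.kappa_orth hw
    obtain ⟨l1, l2, l3, l4⟩ := hf.vconj_kappa_orth hw
    have b2 := a2
    rw [mink_comm] at b2 k1 k2 l1 l2
    have m : mink (kappa f w) (vconj (kappa f w)) = kappaSq f w := rfl
    have e1 := hphE w hw
    have e2 := hqhE w hw
    have cp : vconj (ph w) = c w • (dzbar (Y f) w + (1 / 2 * conj (mu f w)) • Y f w) := by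
      simp only [ph_def, vconj_smul, vconj_add, hcr w hw, ← hf.dzbar_Y hw, ConfOn.vconj_Y, map_mul,
        map_div₀, map_one, Complex.conj_ofNat]
    have cq : vconj (qh w) = c w • vconj (kappa f w) := by
      simp only [qh_def, vconj_smul, hcr w hw]
    refine ⟨?_, ?_, ?_, ?_, ?_, ?_, ?_, ?_⟩
    · rw [hLd _ _ e1 e1]
      simp only [ph_def, mink_smul_left, mink_smul_right, mink_add_left, mink_add_right, a1, a2,
        a4, b2]
      ring
    · rw [hLd _ _ e1 e2]
      simp only [ph_def, qh_def, mink_smul_left, mink_smul_right, mink_add_left, k1, k2]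
      ring
    · rw [hLd _ _ e2 e2]
      simp only [qh_def, mink_smul_left, mink_smul_right, hf.iso w hw]
      ring
    · rw [hLc, hLd _ _ e1 (hcE _ e1), cp]
      simp only [ph_def, mink_smul_left, mink_smul_right, mink_add_left, mink_add_right, a1, a3,
        a5, b2]
      ring
    · rw [hLc, hLd _ _ e1 (hcE _ e2), cq]
      simp only [ph_def, mink_smul_left, mink_smul_right, mink_add_left, l1, l2]
      ring
    · rw [hLc, hLd _ _ e2 (hcE _ e2), cq]
      simp only [qh_def, mink_smul_left, mink_smul_right, m]
      ring
    · have := hc0 w hw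
      simp [this]
    · exact mul_ne_zero (mul_ne_zero (hc0 w hw) (hc0 w hw)) (hf.kappaSq_ne hw)
  have hJ : ∀ w ∈ Ω, complexStructure (1 / 2 * (c w * c w)) (c w * c w * kappaSq f w) (L (ph w))
      (L (qh w)) = complexStructure (1 / 2 * (c z * c z)) (c z * c z * kappaSq f z) (L (ph z))
      (L (qh z)) := by
    intro w hw
    refine complexStructure_eq hΩ hc (k := kappaSq f) (μ := mu f)
      (β := fun v => logDer f v + mu f v) (a := fun w => 1 / 2 * (c w * c w))
      (b := fun w => c w * c w * kappaSq f w) (p := fun w => L (ph w)) (q := fun w => L (qh w))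
      (a' := dzbar fun w => 1 / 2 * (c w * c w)) (b' := dzbar fun w => c w * c w * kappaSq f w)
      hB (fun v _ => ConfOn.kappaSq_conj f v)
      (fun v _ => by ring) hpW hqW (fun v hv => ?_) (fun v hv => ?_) hw hz
    · have h := (((hcW v hv).mul (hcW v hv)).const_mul (1 / 2))
      exact ⟨h.1, h.2.1.trans (by ring), rfl⟩
    · have h := (((hcW v hv).mul (hcW v hv)).mul (hf.hasW_kappaSq hv))
      exact ⟨h.1, h.2.1.trans (by rw [hf.dz_kappaSq hv]; ring), rfl⟩
  have hLY : ∀ w, cx A (Y f w) = (scale f w : ℂ) • rc (nullLift (R (f w))) := by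
    intro w
    have : lift f w = rc (nullLift (f w)) := rfl
    rw [ConfOn.Y_eq, map_smul, this, cx_rc, A_def, rotLift_nullLift]
  -- The product -1 of Y with the null section shows that the surface misses the pole, and that cY
  -- carries exactly the denominator 1 - x₀ of stereographic projection.
  have hcs : ∀ w ∈ Ω, c w * scale f w * (1 - (R (f w) 0 : ℂ)) = 1 := by
    intro w hw
    have e1 := (hf.nullSection_products hw).2.1
    rw [hX w hw, mink_smul_right, ← hA, hAE, hLY, mink_smul_left, mink_rc_poleVec] at e1
    have e2 : rc (nullLift (R (f w))) 0 = 1 := by simp [rc, nullLift]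
    have e3 : rc (nullLift (R (f w))) 1 = (R (f w) 0 : ℂ) := rfl
    rw [e2, e3] at e1
    change c w * _ = _ at e1
    linear_combination -e1
  have hR1 : ∀ w ∈ Ω, R (f w) 0 ≠ 1 := by
    intro w hw h
    have := hcs w hw
    rw [h] at this
    simp at this
  refine ⟨R, _, isOrthogonalComplexStructure_complexStructure (hB z hz), hR1, fun w hw => ?_⟩
  rw [← hJ w hw]
  have hh : ∀ v ∈ Ω, rc (stereo (R (f v))).ofLp = c v • L (Y f v) := by
    intro v hv
    have e := hcs v hv
    have hne : (1 - (R (f v) 0 : ℂ)) ≠ 0 := right_ne_zero_of_mul_eq_one e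
    funext i
    simp only [Pi.smul_apply, hLapp, hLY, smul_eq_mul]
    have e2 : rc (nullLift (R (f v))) i.succ.succ = (R (f v) i.succ : ℂ) := rfl
    rw [e2]
    simp only [rc, stereo]
    push_cast
    rw [div_eq_iff hne]
    linear_combination -(R (f v) i.succ : ℂ) * e
  have hdiff : DifferentiableAt ℝ (fun v => stereo (R (f v))) w :=
    ((contDiffOn_stereo (R.contDiff.comp_contDiffOn hf.smooth) hR1).contDiffAt
      (hΩ.mem_nhds hw)).differentiableAt (by simp)
  have hW1 : HasW (fun v => rc (stereo (R (f v))).ofLp) (L (ph w)) (vconj (L (ph w))) w := by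
    have h := ((hcW w hw).smul ((hf.hasW_Y hw).linearMap L)).congr hΩ hw hh
    have h1 : L (ph w) = (mu f w / 2 * c w) • L (Y f w) + c w • L (dz (Y f) w) := by
      simp only [ph_def, map_smul, map_add]
      module
    rw [← h1] at h
    have h2 := (h.unique (h.vconj.congr hΩ hw fun v _ => (vconj_rc _).symm)).2
    rwa [h2] at h
  have hW2 := fun i => (hW1.apply i).unique (hasW_ofReal_apply hdiff i)
  refine complexStructure_apply_p (hB w hw) ?_ ?_
  · funext i
    simp only [Pi.add_apply]
    rw [(hW2 i).1, (hW2 i).2]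
    simp only [rc]
    ring
  · funext i
    simp only [Pi.smul_apply, Pi.sub_apply, smul_eq_mul]
    rw [(hW2 i).1, (hW2 i).2]
    simp only [rc]
    linear_combination (fderiv ℝ (fun v => stereo (R (f v))) w Complex.I i : ℂ) * Complex.I_mul_I

end IsoOn

/-! ### Surfaces on a Riemann surface -/

theorem IsoOn.mono {n : ℕ} {f : ℂ → EuclideanSpace ℝ (Fin (n + 1))} {Ω Ω' : Set ℂ}
    (hf : IsoOn f Ω) (hΩ' : IsOpen Ω') (h : Ω' ⊆ Ω) : IsoOn f Ω' where
  isOpen := hΩ'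
  smooth := hf.smooth.mono h
  norm z hz := hf.norm z (h hz)
  immersion z hz := hf.immersion z (h hz)
  norm_eq z hz := hf.norm_eq z (h hz)
  orthogonal z hz := hf.orthogonal z (h hz)
  iso z hz := hf.iso z (h hz)
  umb z hz := hf.umb z (h hz)

theorem differentiable_invStereoVec {n : ℕ} :
    Differentiable ℝ (invStereoVec : EuclideanSpace ℝ (Fin n) → _) := by
  suffices h : ContDiff ℝ 1 (invStereoVec : EuclideanSpace ℝ (Fin n) → _) from
    h.differentiable (by simp)
  rw [contDiff_euclidean]
  have hn : ContDiff ℝ 1 fun x : EuclideanSpace ℝ (Fin n) => ‖x‖ ^ 2 := contDiff_id.norm_sq ℝ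
  have hne : ∀ x : EuclideanSpace ℝ (Fin n), ‖x‖ ^ 2 + 1 ≠ 0 := fun x => by positivity
  intro i
  refine Fin.cases ?_ (fun j => ?_) i
  · exact (hn.sub contDiff_const).div (hn.add contDiff_const) hne
  · exact (contDiff_const.mul (EuclideanSpace.proj j : _ →L[ℝ] ℝ).contDiff).div
      (hn.add contDiff_const) hne

/-! ### Local coordinates and their transition maps. -/

section Charts

variable {M : Type*} [TopologicalSpace M] [ChartedSpace ℂ M]

theorem isoOn_inCoord {n : ℕ} {y : M → Sph n} (hy : IsConformalImmersion y) (hiso : IsIsotropic y)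
    (humb : WithoutUmbilics y) {e : OpenPartialHomeomorph M ℂ} (he : e ∈ Coords M) :
    IsoOn (inCoord y e) e.target where
  isOpen := e.open_target
  smooth := hy.smooth e he
  norm z _ := mem_sphere_zero_iff_norm.1 (y (e.symm z)).2
  immersion := hy.immersion e he
  norm_eq := hy.norm_eq e he
  orthogonal := hy.orthogonal e he
  iso := hiso e he
  umb := humb e he

theorem differentiableAt_transition {e e' : OpenPartialHomeomorph M ℂ} (he : e ∈ Coords M)
    (he' : e' ∈ Coords M) {z : ℂ} (hz : z ∈ e'.target) (hz' : e'.symm z ∈ e.source) :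
    DifferentiableAt ℂ (fun w => e (e'.symm w)) z := by
  have h := IsManifold.compatible_of_mem_maximalAtlas he' he
  rw [contDiffGroupoid, mem_groupoid_of_pregroupoid] at h
  have h1 := h.1
  simp only [contDiffPregroupoid, modelWithCornersSelf_coe, modelWithCornersSelf_coe_symm,
    Function.id_comp, Function.comp_id, Set.preimage_id, Set.range_id, Set.inter_univ] at h1
  have hs : (e'.symm.trans e).source ∈ nhds z :=
    (e'.symm.trans e).open_source.mem_nhds (by simp [hz, hz'])
  exact (h1.contDiffAt hs).differentiableAt (by simp)

/-- A map which is holomorphic in one coordinate is so in every other coordinate. -/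
theorem fderiv_holomorphic_transition {m : ℕ} {h : M → EuclideanSpace ℝ (Fin m)}
    {J : EuclideanSpace ℝ (Fin m) →ₗ[ℝ] EuclideanSpace ℝ (Fin m)} (hJ : ∀ v, J (J v) = -v)
    {e e' : OpenPartialHomeomorph M ℂ} (he : e ∈ Coords M)
    (he' : e' ∈ Coords M) {z : ℂ} (hz : z ∈ e'.target) (hz' : e'.symm z ∈ e.source)
    (hd : DifferentiableAt ℝ (h ∘ e.symm) (e (e'.symm z)))
    (hhol : fderiv ℝ (h ∘ e.symm) (e (e'.symm z)) Complex.I =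
      J (fderiv ℝ (h ∘ e.symm) (e (e'.symm z)) 1)) :
    fderiv ℝ (h ∘ e'.symm) z Complex.I = J (fderiv ℝ (h ∘ e'.symm) z 1) := by
  have hτ := (differentiableAt_transition he he' hz hz').hasDerivAt.hasFDerivAt.restrictScalars ℝ
  have hcomp := hd.hasFDerivAt.comp z hτ
  have hev : h ∘ e'.symm =ᶠ[nhds z] (h ∘ e.symm) ∘ fun w => e (e'.symm w) := by
    have hs : e'.target ∩ e'.symm ⁻¹' e.source ∈ nhds z :=
      (e'.isOpen_inter_preimage_symm e.open_source).mem_nhds ⟨hz, hz'⟩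
    refine Filter.eventually_of_mem hs fun w hw => ?_
    simp [e.left_inv hw.2]
  rw [hev.fderiv_eq, hcomp.fderiv]
  set t := deriv (fun w => e (e'.symm w)) z
  set D := fderiv ℝ (h ∘ e.symm) (e (e'.symm z))
  -- The Cauchy-Riemann equation makes D complex linear for J, so it commutes with multiplication by
  -- the derivative t of the holomorphic transition map.
  have hlin : ∀ s : ℂ, D s = s.re • D 1 + s.im • J (D 1) := by
    intro s
    have e1 : s = s.re • (1 : ℂ) + s.im • Complex.I := by simp [Complex.re_add_im]
    conv_lhs => rw [e1]
    rw [map_add, map_smul, map_smul, hhol]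
  have e1 : D (Complex.I * t) = J (D t) := by
    rw [hlin, hlin t, map_add, map_smul, map_smul, hJ]
    simp only [Complex.mul_re, Complex.mul_im, Complex.I_re, Complex.I_im]
    module
  simpa [ContinuousLinearMap.comp_apply] using e1

end Charts

/-- The rotation of the sphere defined by a linear isometry. -/
def rotSph {n : ℕ} (R : EuclideanSpace ℝ (Fin (n + 1)) ≃ₗᵢ[ℝ] EuclideanSpace ℝ (Fin (n + 1)))
    (x : Sph n) : Sph n :=
  ⟨R x.1, by rw [mem_sphere_zero_iff_norm, R.norm_map]; exact mem_sphere_zero_iff_norm.1 x.2⟩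

theorem isMoebius_rotSph {n : ℕ}
    (R : EuclideanSpace ℝ (Fin (n + 1)) ≃ₗᵢ[ℝ] EuclideanSpace ℝ (Fin (n + 1))) :
    IsMoebius (rotSph R) :=
  ⟨rotLift R, mink_rotLift R, fun x => ⟨1, one_ne_zero, by
    rw [rotLift_nullLift, one_smul]; rfl⟩⟩

/-! ### Passage between coordinates and the Riemann surface. -/

section Main

variable {M : Type*} [TopologicalSpace M] [ChartedSpace ℂ M]
  {y : M → Sph 4}

theorem invP_eq_zero_of_locallyMoebius (hy : IsConformalImmersion y) (hiso : IsIsotropic y)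
    (humb : WithoutUmbilics y) (hloc : LocallyMoebiusComplexCurve y)
    {e : OpenPartialHomeomorph M ℂ} (he : e ∈ Coords M) {z : ℂ} (hz : z ∈ e.target) :
    invP (inCoord y e) z = 0 := by
  obtain ⟨U, hU, hzU, J, hJ, h, hh, Φ, ⟨A, hA, hAΦ⟩, hΦ⟩ := hloc (e.symm z)
  have hf : IsoOn (inCoord y e) (e.target ∩ e.symm ⁻¹' U) :=
    (isoOn_inCoord hy hiso humb he).mono (e.isOpen_inter_preimage_symm hU) Set.inter_subset_left
  rw [hf.invP_eq_zero_iff ⟨hz, hzU⟩]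
  refine hf.dzbar_mu_of_complexCurve (hh.smooth e he) hJ.1 (hh.holomorphic e he) hA
    (fun w hw => ?_) ⟨hz, hzU⟩
  obtain ⟨c, hc, hAc⟩ := hAΦ (y (e.symm w))
  refine ⟨c, hc, hAc.trans ?_⟩
  rw [hΦ _ hw.2]
  rfl

theorem locallyMoebius_of_invP_eq_zero [IsManifold 𝓘(ℂ) ω M] (hy : IsConformalImmersion y) (hiso : IsIsotropic y)
    (humb : WithoutUmbilics y)
    (hP : ∀ e ∈ Coords M, ∀ z ∈ e.target, invP (inCoord y e) z = 0) :
    LocallyMoebiusComplexCurve y := by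
  intro p
  set e := chartAt ℂ p with e_def
  have he : e ∈ Coords M := IsManifold.chart_mem_maximalAtlas p
  have hp : p ∈ e.source := mem_chart_source ℂ p
  -- A coordinate ball supplies the convexity under which vanishing derivatives give constants.
  obtain ⟨r, hr, hball⟩ := Metric.isOpen_iff.1 e.open_target (e p) (e.map_source hp)
  have hf : IsoOn (inCoord y e) (Metric.ball (e p) r) :=
    (isoOn_inCoord hy hiso humb he).mono Metric.isOpen_ball hball
  obtain ⟨R, J, hJ, hR1, hhol⟩ := hf.exists_complexCurve (convex_ball _ _)
    (fun w hw => (hf.invP_eq_zero_iff hw).1 (hP e he w (hball hw))) (Metric.mem_ball_self hr)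
  have hyU : ∀ q ∈ e.source ∩ e ⁻¹' Metric.ball (e p) r, R (y q).1 0 ≠ 1 := by
    intro q hq
    have := hR1 (e q) hq.2
    rwa [inCoord, e.left_inv hq.1] at this
  have hsmooth : ∀ e' ∈ Coords M, ContDiffOn ℝ ∞ ((fun q => stereo (R (y q).1)) ∘ e'.symm)
      (e'.target ∩ e'.symm ⁻¹' (e.source ∩ e ⁻¹' Metric.ball (e p) r)) := by
    intro e' he'
    exact contDiffOn_stereo (R.contDiff.comp_contDiffOn
      ((hy.smooth e' he').mono Set.inter_subset_left)) fun z hz => hyU _ hz.2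
  have hopen : IsOpen (e.source ∩ e ⁻¹' Metric.ball (e p) r) :=
    e.isOpen_inter_preimage Metric.isOpen_ball
  have hdiff : ∀ e' ∈ Coords M, ∀ z ∈ e'.target ∩ e'.symm ⁻¹' (e.source ∩ e ⁻¹'
      Metric.ball (e p) r), DifferentiableAt ℝ ((fun q => stereo (R (y q).1)) ∘ e'.symm) z :=
    fun e' he' z hz => ((hsmooth e' he').contDiffAt
      ((e'.isOpen_inter_preimage_symm hopen).mem_nhds hz)).differentiableAt (by simp)
  refine ⟨e.source ∩ e ⁻¹' Metric.ball (e p) r, hopen, ⟨hp, Metric.mem_ball_self hr⟩, J, hJ,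
    fun q => stereo (R (y q).1), ⟨hsmooth, fun e' he' z hz h0 => ?_, fun e' he' z hz => ?_⟩,
    rotSph R, isMoebius_rotSph R, fun q hq => ?_⟩
  -- As y is recovered from its projection by inverse stereographic projection and R⁻¹, a vanishing
  -- derivative of the projection would contradict the immersion property of y.
  · have hev : inCoord y e' =ᶠ[nhds z] (fun x => R.symm (invStereoVec x)) ∘
        ((fun q => stereo (R (y q).1)) ∘ e'.symm) := by
      refine Filter.eventually_of_mem ((e'.isOpen_inter_preimage_symm hopen).mem_nhds hz)
        fun w hw => ?_
      have hn : ‖R (y (e'.symm w)).1‖ = 1 := by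
        rw [R.norm_map]; exact mem_sphere_zero_iff_norm.1 (y (e'.symm w)).2
      simp only [Function.comp_apply, invStereoVec_stereo hn (hyU _ hw.2),
        LinearIsometryEquiv.symm_apply_apply, inCoord]
    have hD : DifferentiableAt ℝ (fun x => R.symm (invStereoVec x))
        (((fun q => stereo (R (y q).1)) ∘ e'.symm) z) :=
      R.symm.differentiableAt.comp _ differentiable_invStereoVec.differentiableAt
    apply hy.immersion e' he' z hz.1
    rw [hev.fderiv_eq, (hD.hasFDerivAt.comp z (hdiff e' he' z hz).hasFDerivAt).fderiv,
      ContinuousLinearMap.comp_apply, h0, map_zero]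
  · have hw : e (e'.symm z) ∈ e.target ∩ e.symm ⁻¹' (e.source ∩ e ⁻¹' Metric.ball (e p) r) := by
      refine ⟨e.map_source hz.2.1, ?_⟩
      simp only [Set.mem_preimage, e.left_inv hz.2.1]
      exact hz.2
    exact fderiv_holomorphic_transition hJ.1 he he' hz.1 hz.2.1 (hdiff e he _ hw)
      (hhol _ hz.2.2)
  · apply Subtype.ext
    have hn : ‖R (y q).1‖ = 1 := by
      rw [R.norm_map]; exact mem_sphere_zero_iff_norm.1 (y q).2
    exact (invStereoVec_stereo hn (hyU q hq)).symm

end Main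

end MoebiusSurface

end

open MoebiusSurface in
theorem mainTheorem5 {M : Type*} [TopologicalSpace M] [ChartedSpace ℂ M]
    [IsManifold 𝓘(ℂ) ω M] (y : M → Sph 4) (hy : IsConformalImmersion y)
    (hiso : IsIsotropic y) (humb : WithoutUmbilics y) :
    List.TFAE [
      ∀ e ∈ Coords M, ∀ z ∈ e.target, invP (inCoord y e) z = 0,
      ∀ e ∈ Coords M, ∀ z ∈ e.target, curvK (inCoord y e) z = 2,
      LocallyMoebiusComplexCurve y] := by
  tfae_have 1 ↔ 2 := by
    constructor <;> intro h e he
    · exact (isoOn_inCoord hy hiso humb he).invP_zero_iff_curvK.1 (h e he)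
    · exact (isoOn_inCoord hy hiso humb he).invP_zero_iff_curvK.2 (h e he)
  tfae_have 1 → 3 := locallyMoebius_of_invP_eq_zero hy hiso humb
  tfae_have 3 → 1 := fun h e he z hz => invP_eq_zero_of_locallyMoebius hy hiso humb h he hz
  tfae_finish
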